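/- For $a\in\mathbb C$ and $\rho>0$ let $\triangle(a,\rho)$ and $\bar\triangle(a,\rho)$ be the open and closed discs with centre $a$ and radius $\rho$, and let $E=\triangle(0,1)$. For an open set $\Omega\subset\mathbb C$ let $L^2_h(\Omega)$ be the space of holomorphic functions on $\Omega$ that are square integrable with respect to Lebesgue measure, and let $$K_\Omega(z)=\sup\Big\{\frac{|f(z)|^2}{\|f\|_{L^2(\Omega)}^2}: f\in L^2_h(\Omega),\ f\not\equiv 0\Big\},\qquad z\in\Omega,$$ be the Bergman kernel of $\Omega$. Let $0<r_j<s_j<t_j$ $(j=1,2,\ldots)$ be real numbers and $z_j\in E$ points such that $z_j\to 0$, $\bar\triangle(z_j,t_j)\cap\bar\triangle(z_k,t_k)=\emptyset$ for $j\ne k$, and $0\notin\bar\triangle(z_j,r_j)$ for all $j$. Assume that for every $j$ $$t_j<e^{-4},\qquad r_j^2<\frac{|z_j|^2}{2},\qquad \frac{r_j^2}{t_j^2}+\frac{s_j}{t_j}+\sqrt{\frac{2\log s_j}{\log r_j}}<1,\qquad \frac{2\log t_j}{\log r_j}+\sqrt{\frac{2\log s_j}{\log r_j}}+\frac{s_j}{t_j}<1,$$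 and that $$\sum_{j=1}^\infty\frac{s_j}{t_j}<\infty,\qquad \sum_{j=1}^\infty\sqrt{\frac{\log s_j}{\log r_j}}<\infty,\qquad \sum_{j=1}^\infty\frac{-1}{\log r_j}<\infty.$$ Put $D=E\setminus\big(\bigcup_{j=1}^\infty\bar\triangle(z_j,r_j)\cup\{0\}\big)$. Then there is a constant $C>0$ such that for every $z\in D$ the series below converges and $$K_D(z)\le C\Big(K_E(z)+\sum_{j=1}^\infty\Big(\frac{1}{|z-z_j|^2(-\log r_j)}+\frac{r_j^2}{(|z-z_j|^2-r_j^2)^2}\Big)\Big).$$ -/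

import Mathlib

open MeasureTheory

/-- The space `L²_h(D)` of square integrable holomorphic functions on a (open) set `D ⊆ ℂ`.
Only the values on `D` matter. -/
def SqIntHol (D : Set ℂ) : Set (ℂ → ℂ) :=
  {f | DifferentiableOn ℂ f D ∧ MemLp f 2 (volume.restrict D)}

/-- The Bergman kernel on the diagonal,
`K_D(z) = sup {|f(z)|² / ‖f‖²_{L²(D)} : f ∈ L²_h(D), f ≢ 0}`, for an open set `D ⊆ ℂ` and `z ∈ D`,
with values in `[0, ∞]`. -/
noncomputable def bergmanKernel (D : Set ℂ) (z : ℂ) : ENNReal :=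
  ⨆ f ∈ {f : ℂ → ℂ | f ∈ SqIntHol D ∧ ∃ w ∈ D, f w ≠ 0},
    ‖f z‖ₑ ^ 2 / eLpNorm f 2 (volume.restrict D) ^ 2

/-- The unit disc `E`. -/
def unitDisc : Set ℂ := Metric.ball 0 1

/-- `E` with the origin and the closed discs of centres `p j` and radii `r j` removed. -/
def holeDomain (p : ℕ → ℂ) (r : ℕ → ℝ) : Set ℂ :=
  unitDisc \ ((⋃ j, Metric.closedBall (p j) (r j)) ∪ {0})

/-! Point evaluation at $z$ is written as $f(z)=\int_D f\,k$ with an explicit kernel $k$, not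
necessarily antiholomorphic. Cauchy–Schwarz then gives $K_D(z)\le\|k\|_{L^2}^2$
(`bergmanKernel_le_of_repr`), so it suffices to find a cheap $k$. By Cauchy–Pompeiu,
$k=-\frac1\pi\,\bar\partial\chi/(w-z)$ works for every cutoff $\chi$ that is compactly supported,
equals 1 near $z$ and vanishes near the complement of $D$ (`integral_mul_dbar_div`). A logarithmic
cutoff between radii $a<b$ has $\|\bar\partial\chi\|^2\lesssim 1/\log(b/a)$.

For $z$ near the origin, $\chi$ has to be cut off at three places. At a fixed outer radius
$\varepsilon$ the cost is bounded, and is absorbed by $K_E\ge 1/(16\pi)$. At the origin the radii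
$\eta^2<\eta$ cost about $|z|^{-2}/\log(1/\eta)$, which is at most 1 once $\eta$ is small depending
on $z$; this also disposes of all but finitely many holes. At the $j$-th hole there are two cases.
If $|z-z_j|\ge s_j$, the annulus between $r_j$ and $s_j$ is free, and $r_j\le s_j^2$ makes its
logarithmic width comparable to $-\log r_j$: this is the first term of the series. If
$4r_j<|z-z_j|<s_j$, the cutoff must stay within radius of order $r_j$ and is too expensive by
itself. Cutoffs $\beta,\beta'$ in the same annulus have the same pairing with holomorphic functions,
so $(z_j-z)^{-1}(\bar\partial\beta'-\bar\partial\beta)$ may be added for free. It replaces the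
constant part of $1/(w-z)$ on the narrow annulus by the cheap wide cutoff, and the remainder costs
$r_j^2/|z-z_j|^4$: this is the second term. The discs of radius $t_j$ are disjoint, so the
contributions of the holes add without cross terms.

Elsewhere, that is for $|z-z_j|\le 4r_j$ or for $z$ away from the origin, the crude bound $K_D(z)\le
C\,\mathrm{dist}(z,\partial D)^{-2}$ suffices (`exists_bergmanKernel_le_of_ball`). It is compared
with the second term of the nearest hole or with $K_E$ (`le_bergmanKernel_unitDisc`). -/

open Complex Filter Topology Set

/-! ### The operator $\bar\partial$ on real cutoffs, and Stokes' theorem -/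

/-- The Wirtinger derivative `∂/∂z̄` of a real-valued function. -/
noncomputable def dbar (φ : ℂ → ℝ) (w : ℂ) : ℂ :=
  ((fderiv ℝ φ w 1 : ℝ) + (fderiv ℝ φ w I : ℝ) * I) / 2

lemma dbar_congr {φ ψ : ℂ → ℝ} {w : ℂ} (h : φ =ᶠ[𝓝 w] ψ) : dbar φ w = dbar ψ w := by
  simp only [dbar, h.fderiv_eq]

lemma dbar_const (c : ℝ) (w : ℂ) : dbar (fun _ => c) w = 0 := by
  simp [dbar]

lemma dbar_eq_zero_of_eventuallyEq {φ : ℂ → ℝ} {w : ℂ} {c : ℝ} (h : φ =ᶠ[𝓝 w] fun _ => c) :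
    dbar φ w = 0 := by
  rw [dbar_congr h, dbar_const]

lemma continuous_dbar {φ : ℂ → ℝ} (h : ContDiff ℝ 1 φ) : Continuous (dbar φ) := by
  have := h.continuous_fderiv one_ne_zero
  unfold dbar
  fun_prop

lemma dbar_sub {φ ψ : ℂ → ℝ} {w : ℂ} (hφ : DifferentiableAt ℝ φ w)
    (hψ : DifferentiableAt ℝ ψ w) : dbar (fun x => φ x - ψ x) w = dbar φ w - dbar ψ w := by
  simp only [dbar, fderiv_fun_sub hφ hψ]
  simp
  ring

lemma dbar_sum {ι : Type*} {J : Finset ι} {φ : ι → ℂ → ℝ} {w : ℂ}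
    (hφ : ∀ i ∈ J, DifferentiableAt ℝ (φ i) w) :
    dbar (fun x => ∑ i ∈ J, φ i x) w = ∑ i ∈ J, dbar (φ i) w := by
  simp only [dbar, fderiv_fun_sum hφ]
  simp [Finset.sum_mul, ← Finset.sum_add_distrib, Finset.sum_div]

lemma dbar_mul {φ ψ : ℂ → ℝ} {w : ℂ} (hφ : DifferentiableAt ℝ φ w)
    (hψ : DifferentiableAt ℝ ψ w) :
    dbar (fun x => φ x * ψ x) w = φ w * dbar ψ w + ψ w * dbar φ w := by
  simp only [dbar, fderiv_fun_mul hφ hψ]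
  simp
  ring

/-- Integration by parts against the constant function 1. -/
lemma integral_fderiv_eq_zero {φ : ℂ → ℂ} (hφ : ContDiff ℝ 1 φ) (hc : HasCompactSupport φ)
    (v : ℂ) : ∫ w, fderiv ℝ φ w v = 0 := by
  have hcont : Continuous fun w => fderiv ℝ φ w v :=
    (hφ.continuous_fderiv one_ne_zero).clm_apply continuous_const
  have hi : Integrable fun w => fderiv ℝ φ w v :=
    hcont.integrable_of_hasCompactSupport (hc.fderiv_apply ℝ v)
  have := integral_smul_fderiv_eq_neg_fderiv_smul_of_integrable (𝕜 := ℝ) (μ := volume)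
    (f := fun _ : ℂ => (1 : ℝ)) (g := φ) (v := v) (by simp) (by simpa using hi)
    (by simpa using hφ.continuous.integrable_of_hasCompactSupport hc)
    (fun x _ => by fun_prop) (fun x _ => (hφ.differentiable one_ne_zero) x)
  simpa using this

/-- Stokes' theorem: a holomorphic function is orthogonal to `∂̄` of a compactly supported
function. -/
lemma integral_mul_dbar_eq_zero {U : Set ℂ} (hU : IsOpen U) {g : ℂ → ℂ}
    (hg : DifferentiableOn ℂ g U) {φ : ℂ → ℝ} (hφ : ContDiff ℝ 1 φ) (hc : HasCompactSupport φ)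
    (h0 : ∀ w ∉ U, φ =ᶠ[𝓝 w] 0) : ∫ w, g w * dbar φ w = 0 := by
  set ψ : ℂ → ℂ := fun w => (φ w : ℂ) * g w with hψ
  have hφ' : ContDiff ℝ 1 fun w => (φ w : ℂ) := ofRealCLM.contDiff.comp hφ
  have hψ0 : ∀ w ∉ U, ψ =ᶠ[𝓝 w] fun _ => 0 := fun w hw => by
    filter_upwards [h0 w hw] with x hx
    simp [hψ, hx]
  have hψd : ContDiff ℝ 1 ψ := by
    rw [contDiff_iff_contDiffAt]
    intro w
    by_cases hw : w ∈ U
    · have h1 : ContDiffAt ℂ 1 g w :=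
        (hg.contDiffOn hU).contDiffAt (hU.mem_nhds hw)
      exact hφ'.contDiffAt.mul (h1.restrict_scalars ℝ)
    · exact contDiffAt_const.congr_of_eventuallyEq (hψ0 w hw)
  have hψc : HasCompactSupport ψ := by
    refine hc.mono fun w hw => ?_
    simp only [hψ, Function.mem_support, ne_eq, mul_eq_zero, not_or] at hw ⊢
    exact_mod_cast hw.1
  have key : ∀ w, g w * dbar φ w = (fderiv ℝ ψ w 1 + I * fderiv ℝ ψ w I) / 2 := by
    intro w
    by_cases hw : w ∈ U
    · have h1 : HasFDerivAt g ((ContinuousLinearMap.toSpanSingleton ℂ (deriv g w)).restrictScalars ℝ) w :=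
        ((hg.differentiableAt (hU.mem_nhds hw)).hasDerivAt.hasFDerivAt).restrictScalars ℝ
      have h2 : HasFDerivAt (fun w => (φ w : ℂ)) (ofRealCLM.comp (fderiv ℝ φ w)) w :=
        ofRealCLM.hasFDerivAt.comp w ((hφ.differentiable one_ne_zero) w).hasFDerivAt
      rw [show fderiv ℝ ψ w = _ from (h2.mul h1).fderiv, dbar]
      simp
      ring_nf
      simp
    · rw [(hψ0 w hw).fderiv_eq, dbar_eq_zero_of_eventuallyEq (c := 0) (h0 w hw)]
      simp
  simp_rw [key]
  have hi : ∀ v, Integrable fun w => fderiv ℝ ψ w v := fun v =>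
    ((hψd.continuous_fderiv one_ne_zero).clm_apply
      continuous_const).integrable_of_hasCompactSupport (hψc.fderiv_apply ℝ v)
  rw [integral_div, integral_add (hi 1) ((hi I).const_mul I), integral_const_mul,
    integral_fderiv_eq_zero hψd hψc, integral_fderiv_eq_zero hψd hψc]
  simp

/-! ### Logarithmic cutoffs on the half-line -/

lemma exists_deriv_smoothTransition_bound : ∃ M : ℝ, 0 < M ∧
    ∀ x, ‖deriv Real.smoothTransition x‖ ≤ M := by
  have hc : Continuous (deriv Real.smoothTransition) :=
    (Real.smoothTransition.contDiff (n := 1)).continuous_deriv le_rfl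
  obtain ⟨M, hM⟩ := (isCompact_Icc (a := (0 : ℝ)) (b := 1)).exists_bound_of_continuousOn
    hc.continuousOn
  refine ⟨max M 1, by positivity, fun x => ?_⟩
  by_cases hx : x ∈ Icc (0 : ℝ) 1
  · exact (hM x hx).trans (le_max_left _ _)
  · have : deriv Real.smoothTransition x = 0 := by
      rw [mem_Icc, not_and_or, not_le, not_le] at hx
      rcases hx with hx | hx
      · have : Real.smoothTransition =ᶠ[𝓝 x] fun _ => 0 := by
          filter_upwards [Iio_mem_nhds hx] with y hy
          exact Real.smoothTransition.zero_of_nonpos (le_of_lt hy)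
        rw [this.deriv_eq]; simp
      · have : Real.smoothTransition =ᶠ[𝓝 x] fun _ => 1 := by
          filter_upwards [Ioi_mem_nhds hx] with y hy
          exact Real.smoothTransition.one_of_one_le (le_of_lt hy)
        rw [this.deriv_eq]; simp
    rw [this, norm_zero]
    positivity

/-- A logarithmic cutoff on the half-line. -/
noncomputable def logCutoff (a b x : ℝ) : ℝ :=
  if x ≤ a then 1 else 1 - Real.smoothTransition ((Real.log x - Real.log a) / Real.log (b / a))

section logCutoff

variable {a b : ℝ}

lemma logCutoff_of_le {x : ℝ} (h : x ≤ a) : logCutoff a b x = 1 := if_pos h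

lemma log_div_pos_of_lt (ha : 0 < a) (hab : a < b) : 0 < Real.log (b / a) :=
  Real.log_pos ((one_lt_div ha).2 hab)

lemma logCutoff_of_ge (ha : 0 < a) (hab : a < b) {x : ℝ} (h : b ≤ x) : logCutoff a b x = 0 := by
  rw [logCutoff, if_neg (by linarith), Real.smoothTransition.one_of_one_le, sub_self]
  rw [one_le_div (log_div_pos_of_lt ha hab), Real.log_div (by linarith) ha.ne']
  have := Real.log_le_log (by linarith) h
  linarith

lemma logCutoff_nonneg (x : ℝ) : 0 ≤ logCutoff a b x := by
  unfold logCutoff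
  split_ifs
  · exact zero_le_one
  · linarith [Real.smoothTransition.le_one ((Real.log x - Real.log a) / Real.log (b / a))]

lemma logCutoff_le_one (x : ℝ) : logCutoff a b x ≤ 1 := by
  unfold logCutoff
  split_ifs
  · exact le_rfl
  · linarith [Real.smoothTransition.nonneg ((Real.log x - Real.log a) / Real.log (b / a))]

/-- The case distinction in the definition matters only for $x\le 0$, where `Real.log` takes default
values; on $(0,a]$ the smooth transition already vanishes. -/
lemma logCutoff_eq (ha : 0 < a) (hab : a < b) {x : ℝ} (hx : 0 < x) :
    logCutoff a b x =
      1 - Real.smoothTransition ((Real.log x - Real.log a) / Real.log (b / a)) := by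
  by_cases h : x ≤ a
  · rw [logCutoff_of_le h, Real.smoothTransition.zero_of_nonpos, sub_zero]
    apply div_nonpos_of_nonpos_of_nonneg _ (log_div_pos_of_lt ha hab).le
    linarith [Real.log_le_log hx h]
  · rw [logCutoff, if_neg h]

lemma hasDerivAt_logCutoff (ha : 0 < a) (hab : a < b) {x : ℝ} (hx : 0 < x) :
    HasDerivAt (logCutoff a b)
      (-(deriv Real.smoothTransition ((Real.log x - Real.log a) / Real.log (b / a)) *
        (x⁻¹ / Real.log (b / a)))) x := by
  have h1 : HasDerivAt (fun x => (Real.log x - Real.log a) / Real.log (b / a))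
      (x⁻¹ / Real.log (b / a)) x :=
    ((Real.hasDerivAt_log hx.ne').sub_const _).div_const _
  have h2 : HasDerivAt Real.smoothTransition _
      ((Real.log x - Real.log a) / Real.log (b / a)) :=
    ((Real.smoothTransition.contDiff (n := 1)).differentiable one_ne_zero _).hasDerivAt
  refine ((h2.comp x h1).const_sub 1).congr_of_eventuallyEq ?_
  filter_upwards [Ioi_mem_nhds hx] with y hy
  exact logCutoff_eq ha hab hy

lemma contDiff_logCutoff (ha : 0 < a) (hab : a < b) : ContDiff ℝ 1 (logCutoff a b) := by
  rw [contDiff_iff_contDiffAt]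
  intro x
  by_cases hx : 0 < x
  · have : ContDiffAt ℝ 1 (fun x =>
        1 - Real.smoothTransition ((Real.log x - Real.log a) / Real.log (b / a))) x := by
      refine contDiffAt_const.sub (ContDiffAt.comp x
        (Real.smoothTransition.contDiffAt (n := 1)) ?_)
      exact ((Real.contDiffAt_log.2 hx.ne').sub contDiffAt_const).div_const _
    refine this.congr_of_eventuallyEq ?_
    filter_upwards [Ioi_mem_nhds hx] with y hy
    exact logCutoff_eq ha hab hy
  · refine (contDiffAt_const (c := (1 : ℝ))).congr_of_eventuallyEq ?_
    filter_upwards [Iio_mem_nhds (show x < a by linarith)] with y hy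
    exact logCutoff_of_le (le_of_lt hy)

lemma abs_deriv_logCutoff_le (ha : 0 < a) (hab : a < b) {M : ℝ}
    (hM : ∀ x, ‖deriv Real.smoothTransition x‖ ≤ M) {x : ℝ} (hx : 0 < x) :
    |deriv (logCutoff a b) x| ≤ M / (x * Real.log (b / a)) := by
  have hL := log_div_pos_of_lt ha hab
  rw [(hasDerivAt_logCutoff ha hab hx).deriv, abs_neg, abs_mul,
    abs_of_pos (show 0 < x⁻¹ / Real.log (b / a) by positivity)]
  calc _ ≤ M * (x⁻¹ / Real.log (b / a)) := by
        gcongr; exact hM _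
    _ = _ := by field_simp

end logCutoff

/-! ### Radial cutoffs in the plane and their $\bar\partial$-energy -/

/-- The radial cutoff, equal to `1` on the disc of radius `a` about `c` and to `0` off the disc of
radius `b`. -/
noncomputable def bump (c : ℂ) (a b : ℝ) (w : ℂ) : ℝ := logCutoff a b ‖w - c‖

section bump

variable {c : ℂ} {a b : ℝ}

lemma bump_of_le {w : ℂ} (h : ‖w - c‖ ≤ a) : bump c a b w = 1 := logCutoff_of_le h

lemma bump_of_ge (ha : 0 < a) (hab : a < b) {w : ℂ} (h : b ≤ ‖w - c‖) : bump c a b w = 0 :=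
  logCutoff_of_ge ha hab h

lemma bump_nonneg (w : ℂ) : 0 ≤ bump c a b w := logCutoff_nonneg _

lemma bump_le_one (w : ℂ) : bump c a b w ≤ 1 := logCutoff_le_one _

lemma bump_eventuallyEq_one {w : ℂ} (h : ‖w - c‖ < a) : bump c a b =ᶠ[𝓝 w] fun _ => 1 := by
  have : ∀ᶠ x in 𝓝 w, ‖x - c‖ < a :=
    (by fun_prop : Continuous fun x : ℂ => ‖x - c‖).continuousAt.eventually_lt
      continuousAt_const h
  filter_upwards [this] with x hx using bump_of_le hx.le

lemma bump_eventuallyEq_zero (ha : 0 < a) (hab : a < b) {w : ℂ} (h : b < ‖w - c‖) :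
    bump c a b =ᶠ[𝓝 w] fun _ => 0 := by
  have : ∀ᶠ x in 𝓝 w, b < ‖x - c‖ :=
    continuousAt_const.eventually_lt
      (by fun_prop : Continuous fun x : ℂ => ‖x - c‖).continuousAt h
  filter_upwards [this] with x hx using bump_of_ge ha hab hx.le

lemma contDiff_bump (ha : 0 < a) (hab : a < b) : ContDiff ℝ 1 (bump c a b) := by
  rw [contDiff_iff_contDiffAt]
  intro w
  by_cases hw : w = c
  · exact contDiffAt_const.congr_of_eventuallyEq (bump_eventuallyEq_one (by simpa [hw]))
  · exact ContDiffAt.comp w (contDiff_logCutoff ha hab).contDiffAt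
      ((contDiffAt_id.sub contDiffAt_const).norm ℝ (sub_ne_zero.2 hw))

lemma hasCompactSupport_bump (ha : 0 < a) (hab : a < b) : HasCompactSupport (bump c a b) := by
  refine HasCompactSupport.intro (isCompact_closedBall c b) fun w hw => ?_
  rw [Metric.mem_closedBall, dist_eq_norm, not_le] at hw
  exact bump_of_ge ha hab hw.le

lemma dbar_bump_of_lt {w : ℂ} (h : ‖w - c‖ < a) : dbar (bump c a b) w = 0 :=
  dbar_eq_zero_of_eventuallyEq (bump_eventuallyEq_one h)

lemma dbar_bump_of_gt (ha : 0 < a) (hab : a < b) {w : ℂ} (h : b < ‖w - c‖) :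
    dbar (bump c a b) w = 0 :=
  dbar_eq_zero_of_eventuallyEq (bump_eventuallyEq_zero ha hab h)

/-- Obtained by differentiating $\|x-c\|^2$ in two ways. -/
lemma fderiv_norm_sub_apply {w : ℂ} (hw : w ≠ c) (v : ℂ) :
    fderiv ℝ (fun x => ‖x - c‖) w v = inner ℝ (w - c) v / ‖w - c‖ := by
  have hne : w - c ≠ 0 := sub_ne_zero.2 hw
  have hd : DifferentiableAt ℝ (fun x : ℂ => ‖x - c‖) w :=
    (differentiableAt_id.sub_const c).norm ℝ hne
  have h1 := (hd.hasFDerivAt.pow 2).fderiv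
  have h2 : HasFDerivAt (fun x : ℂ => ‖x - c‖ ^ 2) _ w :=
    ((hasFDerivAt_id w).sub_const c).norm_sq
  have h3 := congrArg (fun T : ℂ →L[ℝ] ℝ => T v)
    ((hd.hasFDerivAt.pow 2).unique h2)
  simp at h3
  rw [eq_div_iff (norm_ne_zero_iff.2 hne), mul_comm]
  simp [Complex.inner]
  linarith

lemma dbar_bump_eq (ha : 0 < a) (hab : a < b) {w : ℂ} (hw : w ≠ c) :
    dbar (bump c a b) w = (deriv (logCutoff a b) ‖w - c‖ / (2 * ‖w - c‖) : ℝ) * (w - c) := by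
  have hne : w - c ≠ 0 := sub_ne_zero.2 hw
  have hd : DifferentiableAt ℝ (fun x : ℂ => ‖x - c‖) w :=
    (differentiableAt_id.sub_const c).norm ℝ hne
  have h1 : HasDerivAt (logCutoff a b) _ ‖w - c‖ :=
    ((contDiff_logCutoff ha hab).differentiable one_ne_zero _).hasDerivAt
  have h2 := (h1.comp_hasFDerivAt w hd.hasFDerivAt).fderiv
  rw [dbar, show fderiv ℝ (bump c a b) w = _ from h2]
  simp only [smul_apply, smul_eq_mul, fderiv_norm_sub_apply hw]
  have e1 : inner ℝ (w - c) (1 : ℂ) = (w - c).re := by simp [Complex.inner]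
  have e2 : inner ℝ (w - c) I = (w - c).im := by simp [Complex.inner]; ring
  rw [e1, e2]
  have key := re_add_im (w - c)
  generalize (w - c).re = x at *
  generalize (w - c).im = y at *
  push_cast
  linear_combination (((deriv (logCutoff a b) ‖w - c‖ : ℝ) : ℂ) / (2 * ((‖w - c‖ : ℝ) : ℂ))) * key

lemma norm_dbar_bump_le (ha : 0 < a) (hab : a < b) {M : ℝ}
    (hM : ∀ x, ‖deriv Real.smoothTransition x‖ ≤ M) (w : ℂ) :
    ‖dbar (bump c a b) w‖ ≤
      (Icc a b).indicator (fun x => M / (x * Real.log (b / a))) ‖w - c‖ := by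
  by_cases h : ‖w - c‖ ∈ Icc a b
  · rw [indicator_of_mem h]
    have hpos : 0 < ‖w - c‖ := ha.trans_le h.1
    have hw : w ≠ c := fun h' => by simp [h'] at hpos
    have h2 := abs_deriv_logCutoff_le ha hab hM hpos
    rw [dbar_bump_eq ha hab hw, norm_mul, norm_real, Real.norm_eq_abs, abs_div,
      abs_of_pos (show 0 < 2 * ‖w - c‖ by positivity)]
    have h0 := abs_nonneg (deriv (logCutoff a b) ‖w - c‖)
    calc _ = |deriv (logCutoff a b) ‖w - c‖| / 2 := by field_simp
      _ ≤ _ := by linarith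
  · rw [indicator_of_notMem h]
    rw [mem_Icc, not_and_or, not_le, not_le] at h
    rcases h with h | h
    · rw [dbar_bump_of_lt h, norm_zero]
    · rw [dbar_bump_of_gt ha hab h, norm_zero]

lemma continuous_dbar_bump (ha : 0 < a) (hab : a < b) : Continuous (dbar (bump c a b)) :=
  continuous_dbar (contDiff_bump ha hab)

lemma integral_norm_sub (F : ℝ → ℝ) :
    ∫ w : ℂ, F ‖w - c‖ = 2 * Real.pi * ∫ y in Ioi (0 : ℝ), y * F y := by
  rw [integral_sub_right_eq_self (fun w : ℂ => F ‖w‖) c, integral_fun_norm_addHaar]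
  have : (volume : Measure ℂ).real (Metric.ball 0 1) = Real.pi := by
    simp [Measure.real, Complex.volume_ball]
  simp [this, Complex.finrank_real_complex]
  ring

/-- In polar coordinates the integrand is $L'(\rho)/(2\rho)$ with $L$ the cutoff profile, so the
integral is $\pi\int_0^\infty L'=\pi(0-1)$. This is the normalisation of the Cauchy–Pompeiu formula.
-/
lemma integral_dbar_bump_div (ha : 0 < a) (hab : a < b) :
    ∫ w, dbar (bump c a b) w / (w - c) = -Real.pi := by
  have h1 : ∀ w : ℂ, dbar (bump c a b) w / (w - c) =
      ((deriv (logCutoff a b) ‖w - c‖ / (2 * ‖w - c‖) : ℝ) : ℂ) := by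
    intro w
    by_cases hw : w = c
    · simp [hw]
    · rw [dbar_bump_eq ha hab hw, mul_div_assoc, div_self (sub_ne_zero.2 hw), mul_one]
  simp_rw [h1]
  rw [integral_complex_ofReal, integral_norm_sub (fun x => deriv (logCutoff a b) x / (2 * x))]
  have h2 : ∫ y in Ioi (0 : ℝ), y * (deriv (logCutoff a b) y / (2 * y)) =
      ∫ y in Ioi (0 : ℝ), deriv (logCutoff a b) y / 2 :=
    setIntegral_congr_fun measurableSet_Ioi fun y (hy : 0 < y) => by
      field_simp
  have hd := contDiff_logCutoff ha hab
  have hc : Continuous (deriv (logCutoff a b)) := hd.continuous_deriv le_rfl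
  have h0 : ∀ y, b < y → deriv (logCutoff a b) y = 0 := fun y hy => by
    have : logCutoff a b =ᶠ[𝓝 y] fun _ => 0 := by
      filter_upwards [Ioi_mem_nhds hy] with x hx using logCutoff_of_ge ha hab (le_of_lt hx)
    rw [this.deriv_eq, deriv_const]
  have hint : IntegrableOn (deriv (logCutoff a b)) (Ioi 0) := by
    have : IntegrableOn (deriv (logCutoff a b)) (Ioc 0 b ∪ Ioi b) :=
      ((hc.integrableOn_Icc (a := 0) (b := b)).mono_set Ioc_subset_Icc_self).union
        ((integrableOn_zero).congr_fun (fun y hy => (h0 y hy).symm) measurableSet_Ioi)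
    rwa [Ioc_union_Ioi_eq_Ioi (by linarith)] at this
  have h3 : ∫ y in Ioi (0 : ℝ), deriv (logCutoff a b) y = 0 - logCutoff a b 0 := by
    refine integral_Ioi_of_hasDerivAt_of_tendsto hd.continuous.continuousWithinAt
      (fun x _ => (hd.differentiable one_ne_zero x).hasDerivAt) hint ?_
    refine tendsto_const_nhds.congr' ?_
    filter_upwards [eventually_ge_atTop b] with x hx using (logCutoff_of_ge ha hab hx).symm
  rw [h2, integral_div, h3, logCutoff_of_le ha.le]
  push_cast
  ring

/-- With $L=\log(b/a)$, the bound integrates to $2\pi\int_a^b \frac{M^2}{x^2L^2}\,x\,dx=2\pi M^2/L$: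
one of the two factors $1/L$ survives. -/
lemma lintegral_sq_le_of_annulus (ha : 0 < a) (hab : a < b) {M : ℝ} {k : ℂ → ℂ}
    (hk : ∀ w, ‖k w‖ ≤ (Icc a b).indicator (fun x => M / (x * Real.log (b / a))) ‖w - c‖) :
    ∫⁻ w, ‖k w‖ₑ ^ 2 ≤ ENNReal.ofReal (2 * Real.pi * M ^ 2 / Real.log (b / a)) := by
  have hL := log_div_pos_of_lt ha hab
  set L := Real.log (b / a) with hLdef
  set F : ℝ → ℝ := (Icc a b).indicator (fun x => (M / (x * L)) ^ 2) with hF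
  have hsub : Icc a b ⊆ Ioi 0 := fun x hx => ha.trans_le hx.1
  have h1 : ∀ w, ‖k w‖ₑ ^ 2 ≤ ENNReal.ofReal (F ‖w - c‖) := by
    intro w
    rw [← ofReal_norm, ← ENNReal.ofReal_pow (norm_nonneg _)]
    refine ENNReal.ofReal_le_ofReal ?_
    have h := hk w
    by_cases hw : ‖w - c‖ ∈ Icc a b
    · rw [indicator_of_mem hw] at h
      rw [hF, indicator_of_mem hw]
      exact pow_le_pow_left₀ (norm_nonneg _) h 2
    · rw [indicator_of_notMem hw] at h
      rw [hF, indicator_of_notMem hw, le_antisymm h (norm_nonneg _)]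
      simp
  have hF0 : ∀ x, 0 ≤ F x := fun x => indicator_nonneg (fun _ _ => sq_nonneg _) x
  have hyF : ∀ y, y * F y = (Icc a b).indicator (fun x => M ^ 2 / L ^ 2 * x⁻¹) y := by
    intro y
    by_cases hy : y ∈ Icc a b
    · have : 0 < y := ha.trans_le hy.1
      rw [hF, indicator_of_mem hy, indicator_of_mem hy]
      field_simp
    · rw [hF, indicator_of_notMem hy, indicator_of_notMem hy, mul_zero]
  have hii : IntegrableOn (fun x => M ^ 2 / L ^ 2 * x⁻¹) (Icc a b) :=
    (ContinuousOn.mul continuousOn_const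
      (continuousOn_inv₀.mono fun x hx => (ha.trans_le hx.1).ne')).integrableOn_Icc
  have hint : Integrable (fun w : ℂ => F ‖w - c‖) := by
    refine Integrable.comp_sub_right (f := fun w : ℂ => F ‖w‖) ?_ c
    rw [integrable_fun_norm_addHaar]
    simp only [Complex.finrank_real_complex, Nat.add_one_sub_one, pow_one, smul_eq_mul, hyF]
    exact (integrable_indicator_iff measurableSet_Icc).2 hii |>.integrableOn
  calc ∫⁻ w, ‖k w‖ₑ ^ 2 ≤ ∫⁻ w, ENNReal.ofReal (F ‖w - c‖) := lintegral_mono h1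
    _ = ENNReal.ofReal (∫ w : ℂ, F ‖w - c‖) :=
        (ofReal_integral_eq_lintegral_ofReal hint (Eventually.of_forall fun w => hF0 _)).symm
    _ = _ := by
        congr 1
        rw [integral_norm_sub, mul_div_assoc]
        congr 1
        simp_rw [hyF]
        rw [setIntegral_indicator measurableSet_Icc,
          inter_eq_right.2 hsub, integral_const_mul,
          integral_Icc_eq_integral_Ioc, ← intervalIntegral.integral_of_le hab.le,
          integral_inv_of_pos ha (ha.trans hab), ← hLdef]
        field_simp

end bump

/-! ### The Cauchy–Pompeiu formula -/

lemma dbar_eventuallyEq_zero {φ : ℂ → ℝ} {w : ℂ} {c : ℝ} (h : φ =ᶠ[𝓝 w] fun _ => c) :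
    dbar φ =ᶠ[𝓝 w] 0 := by
  filter_upwards [h.eventually_nhds] with x hx using dbar_eq_zero_of_eventuallyEq hx

lemma hasCompactSupport_dbar {φ : ℂ → ℝ} (hc : HasCompactSupport φ) :
    HasCompactSupport (dbar φ) := by
  refine hc.of_isClosed_subset (isClosed_tsupport _) ?_
  refine closure_minimal (fun w hw => ?_) (isClosed_tsupport _)
  by_contra h
  exact hw (dbar_eq_zero_of_eventuallyEq (c := 0) (notMem_tsupport_iff_eventuallyEq.1 h))

lemma continuous_mul_dbar {U : Set ℂ} (hU : IsOpen U) {g : ℂ → ℂ} (hg : ContinuousOn g U)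
    {φ : ℂ → ℝ} (hφ : ContDiff ℝ 1 φ) (h0 : ∀ w ∉ U, dbar φ =ᶠ[𝓝 w] 0) :
    Continuous fun w => g w * dbar φ w := by
  rw [continuous_iff_continuousAt]
  intro w
  by_cases hw : w ∈ U
  · exact (hg.continuousAt (hU.mem_nhds hw)).mul (continuous_dbar hφ).continuousAt
  · refine (continuousAt_const (y := (0 : ℂ))).congr_of_eventuallyEq (?_ : _ =ᶠ[𝓝 w] _)
    filter_upwards [h0 w hw] with x hx
    simp [hx]

lemma integrable_mul_dbar {U : Set ℂ} (hU : IsOpen U) {g : ℂ → ℂ} (hg : ContinuousOn g U)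
    {φ : ℂ → ℝ} (hφ : ContDiff ℝ 1 φ) (hc : HasCompactSupport φ)
    (h0 : ∀ w ∉ U, dbar φ =ᶠ[𝓝 w] 0) : Integrable fun w => g w * dbar φ w :=
  (continuous_mul_dbar hU hg hφ h0).integrable_of_hasCompactSupport
    (hasCompactSupport_dbar hc).mul_left

/-- The Cauchy–Pompeiu formula for a cutoff function. -/
lemma integral_mul_dbar_div {U : Set ℂ} (hU : IsOpen U) {f : ℂ → ℂ}
    (hf : DifferentiableOn ℂ f U) {z : ℂ} (hz : z ∈ U) {χ : ℂ → ℝ} (hχ : ContDiff ℝ 1 χ)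
    (hc : HasCompactSupport χ) (hχz : χ =ᶠ[𝓝 z] fun _ => 1) (h0 : ∀ w ∉ U, χ =ᶠ[𝓝 w] 0) :
    Integrable (fun w => f w * (dbar χ w / (w - z))) ∧
      ∫ w, f w * (dbar χ w / (w - z)) = -Real.pi * f z := by
  obtain ⟨d, hd, hdU⟩ := Metric.isOpen_iff.1 hU z hz
  have ha : 0 < d / 4 := by positivity
  have hab : d / 4 < d / 2 := by linarith
  -- A small cutoff at $z$ isolates the pole. Since $\chi-\beta$ vanishes near $z$, Stokes for
  -- $f/(w-z)$ on $U\setminus\{z\}$ replaces $\chi$ by $\beta$. In the disc,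
  -- $f(w)=f(z)+(w-z)\,$`dslope f z w`, and Stokes removes the second summand, leaving the radial
  -- integral.
  set β := bump z (d / 4) (d / 2) with hβ
  have hβz : β =ᶠ[𝓝 z] fun _ => 1 := bump_eventuallyEq_one (by simpa)
  have hβ0 : ∀ w ∉ U, β =ᶠ[𝓝 w] 0 := fun w hw => by
    refine bump_eventuallyEq_zero ha hab ?_
    by_contra! h
    exact hw (hdU (by rw [Metric.mem_ball, dist_eq_norm]; linarith))
  have hβd : ContDiff ℝ 1 β := contDiff_bump ha hab
  have hβc : HasCompactSupport β := hasCompactSupport_bump ha hab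
  have hV : IsOpen (U \ {z}) := hU.sdiff isClosed_singleton
  set g : ℂ → ℂ := fun w => f w / (w - z) with hg
  have hgV : DifferentiableOn ℂ g (U \ {z}) :=
    (hf.mono sdiff_subset).div (by fun_prop) fun w hw => sub_ne_zero.2 hw.2
  have cases : ∀ w ∉ U \ {z}, w ∉ U ∨ w = z := fun w hw => by
    by_contra! h
    exact hw ⟨h.1, h.2⟩
  have e1 : ∫ w, g w * dbar (fun x => χ x - β x) w = 0 := by
    refine integral_mul_dbar_eq_zero hV hgV (hχ.sub hβd) (hc.sub hβc) fun w hw => ?_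
    rcases cases w hw with h | rfl
    · filter_upwards [h0 w h, hβ0 w h] with x h1 h2
      simp [h1, h2]
    · filter_upwards [hχz, hβz] with x h1 h2
      simp [h1, h2]
  have i1 : Integrable fun w => g w * dbar χ w := by
    refine integrable_mul_dbar hV hgV.continuousOn hχ hc fun w hw => ?_
    rcases cases w hw with h | rfl
    · exact dbar_eventuallyEq_zero (c := 0) (h0 w h)
    · exact dbar_eventuallyEq_zero hχz
  have hβV : ∀ w ∉ U \ {z}, dbar β =ᶠ[𝓝 w] 0 := fun w hw => by
    rcases cases w hw with h | rfl
    · exact dbar_eventuallyEq_zero (c := 0) (hβ0 w h)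
    · exact dbar_eventuallyEq_zero hβz
  have i2 : Integrable fun w => g w * dbar β w :=
    integrable_mul_dbar hV hgV.continuousOn hβd hβc hβV
  have i3 : Integrable fun w => f z * (dbar β w / (w - z)) := by
    have : Integrable fun w => (w - z)⁻¹ * dbar β w :=
      integrable_mul_dbar hV
        (ContinuousOn.inv₀ (by fun_prop) fun w hw => sub_ne_zero.2 hw.2) hβd hβc hβV
    refine (this.const_mul (f z)).congr (Eventually.of_forall fun w => ?_)
    simp only []
    ring
  have e2 : ∫ w, dslope f z w * dbar β w = 0 :=
    integral_mul_dbar_eq_zero hU ((differentiableOn_dslope (hU.mem_nhds hz)).2 hf) hβd hβc hβ0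
  have e3 : ∫ w, g w * dbar χ w = ∫ w, g w * dbar β w := by
    rw [← sub_eq_zero, ← integral_sub i1 i2, ← e1]
    congr 1 with w
    rw [dbar_sub (hχ.differentiable one_ne_zero w) (hβd.differentiable one_ne_zero w)]
    ring
  have e4 : ∫ w, g w * dbar β w = ∫ w, f z * (dbar β w / (w - z)) := by
    rw [← sub_eq_zero, ← integral_sub i2 i3, ← e2]
    congr 1 with w
    by_cases hw : w = z
    · simp [hw, dbar_eq_zero_of_eventuallyEq hβz]
    · rw [dslope_of_ne _ hw, slope_def_field]
      have := sub_ne_zero.2 hw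
      simp only [hg]
      field_simp
  have e5 : (fun w => f w * (dbar χ w / (w - z))) = fun w => g w * dbar χ w := by
    ext w
    simp only [hg]
    ring
  rw [e5]
  refine ⟨i1, ?_⟩
  rw [e3, e4, integral_const_mul, integral_dbar_bump_div ha hab]
  ring

/-! ### General bounds for Bergman kernels -/

lemma eLpNorm_two_sq {D : Set ℂ} (f : ℂ → ℂ) :
    eLpNorm f 2 (volume.restrict D) ^ 2 = ∫⁻ w in D, ‖f w‖ₑ ^ 2 := by
  have := eLpNorm_nnreal_pow_eq_lintegral (f := f) (μ := volume.restrict D)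
    (p := 2) two_ne_zero
  simpa using this

/-- A function representing evaluation at `z` bounds the Bergman kernel. -/
lemma bergmanKernel_le_of_repr {D : Set ℂ} {z : ℂ} {k : ℂ → ℂ}
    (hk : AEMeasurable k (volume.restrict D))
    (h : ∀ f ∈ SqIntHol D, ∫ w in D, f w * k w = f z) :
    bergmanKernel D z ≤ ∫⁻ w in D, ‖k w‖ₑ ^ 2 := by
  refine iSup₂_le fun f hf => ENNReal.div_le_of_le_mul ?_
  have h1 : ‖f z‖ₑ ≤ ∫⁻ w in D, ‖k w‖ₑ * ‖f w‖ₑ := by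
    rw [← h f hf.1]
    refine (enorm_integral_le_lintegral_enorm _).trans (le_of_eq ?_)
    simp [enorm_mul, mul_comm]
  have h2 := ENNReal.lintegral_mul_le_Lp_mul_Lq (volume.restrict D) Real.HolderConjugate.two_two
    hk.enorm (hf.1.2.1.aemeasurable.enorm)
  have h3 := h1.trans h2
  rw [eLpNorm_two_sq]
  calc ‖f z‖ₑ ^ 2 ≤ _ := pow_le_pow_left' h3 2
    _ = _ := by
      rw [mul_pow, ← ENNReal.rpow_mul_natCast, ← ENNReal.rpow_mul_natCast]
      norm_num

/-- The constant depends only on the transition function. It serves every centre and every pair of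
radii, which is what makes the final constant independent of $z$ and of the hole. -/
lemma exists_lintegral_dbar_bump_bound : ∃ C : ℝ, 0 < C ∧ ∀ (c : ℂ) (a b B : ℝ) (k : ℂ → ℂ),
    0 < a → a < b → 0 ≤ B → (∀ w, ‖k w‖ ≤ B * ‖dbar (bump c a b) w‖) →
    ∫⁻ w, ‖k w‖ₑ ^ 2 ≤ ENNReal.ofReal (C * B ^ 2 / Real.log (b / a)) := by
  obtain ⟨M, hM0, hM⟩ := exists_deriv_smoothTransition_bound
  refine ⟨2 * Real.pi * M ^ 2, by positivity, fun c a b B k ha hab hB hk => ?_⟩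
  refine (lintegral_sq_le_of_annulus (c := c) (M := B * M) ha hab fun w => ?_).trans
    (le_of_eq (by ring_nf))
  refine (hk w).trans ((mul_le_mul_of_nonneg_left (norm_dbar_bump_le ha hab hM w) hB).trans
    (le_of_eq ?_))
  by_cases h : ‖w - c‖ ∈ Icc a b
  · rw [indicator_of_mem h, indicator_of_mem h]
    ring
  · rw [indicator_of_notMem h, indicator_of_notMem h, mul_zero]

/-- The representing kernel comes from a cutoff with radii $d/4$ and $d/2$ around $z$; there
$|w-z|\ge d/4$ and the logarithmic width is $\log 2$. -/
lemma exists_bergmanKernel_le_of_ball : ∃ C : ℝ, 0 < C ∧ ∀ (D : Set ℂ) (z : ℂ) (d : ℝ), 0 < d →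
    Metric.ball z d ⊆ D → bergmanKernel D z ≤ ENNReal.ofReal (C / d ^ 2) := by
  obtain ⟨C, hC, hb⟩ := exists_lintegral_dbar_bump_bound
  refine ⟨C * (4 / Real.pi) ^ 2 / Real.log 2, by positivity, fun D z d hd hD => ?_⟩
  have ha : 0 < d / 4 := by positivity
  have hab : d / 4 < d / 2 := by linarith
  set β := bump z (d / 4) (d / 2) with hβ
  set k : ℂ → ℂ := fun w => -(1 / Real.pi : ℂ) * (dbar β w / (w - z)) with hk
  have hkm : Measurable k := by
    have := (continuous_dbar_bump (c := z) ha hab).measurable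
    rw [hk]
    fun_prop
  have hpi : (Real.pi : ℂ) ≠ 0 := by exact_mod_cast Real.pi_ne_zero
  have hk0 : ∀ w ∉ Metric.ball z d, k w = 0 := fun w hw => by
    rw [Metric.mem_ball, dist_eq_norm, not_lt] at hw
    simp only [hk, hβ]
    rw [dbar_bump_of_gt ha hab (by linarith)]
    simp
  refine (bergmanKernel_le_of_repr hkm.aemeasurable fun f hf => ?_).trans
    ((setLIntegral_le_lintegral _ _).trans ?_)
  · rw [setIntegral_eq_integral_of_forall_compl_eq_zero fun w hw => by
      rw [hk0 w fun h => hw (hD h), mul_zero]]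
    have := And.right <| integral_mul_dbar_div Metric.isOpen_ball (hf.1.mono hD) (Metric.mem_ball_self hd)
      (contDiff_bump (c := z) ha hab) (hasCompactSupport_bump ha hab)
      (bump_eventuallyEq_one (by simpa)) fun w hw => by
        rw [Metric.mem_ball, dist_eq_norm, not_lt] at hw
        exact bump_eventuallyEq_zero ha hab (by linarith)
    calc ∫ w, f w * k w = ∫ w, -(1 / Real.pi : ℂ) * (f w * (dbar β w / (w - z))) := by
          congr 1 with w
          simp only [hk]
          ring
      _ = _ := by
          rw [integral_const_mul, this]
          field_simp
  · refine (hb z (d / 4) (d / 2) (4 / (Real.pi * d)) k ha hab (by positivity) fun w => ?_).trans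
      (ENNReal.ofReal_le_ofReal (le_of_eq ?_))
    · by_cases hw : ‖w - z‖ < d / 4
      · simp only [hk, hβ]
        rw [dbar_bump_of_lt hw]
        simp
      · rw [not_lt] at hw
        simp only [hk, norm_mul, norm_neg, norm_div, norm_one, norm_real, Real.norm_eq_abs,
          abs_of_pos Real.pi_pos]
        have h1 : ‖dbar β w‖ / ‖w - z‖ ≤ ‖dbar β w‖ / (d / 4) := by gcongr
        calc 1 / Real.pi * (‖dbar β w‖ / ‖w - z‖) ≤ 1 / Real.pi * (‖dbar β w‖ / (d / 4)) := by
              gcongr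
          _ = _ := by rw [hβ]; field_simp
    · rw [show d / 2 / (d / 4) = 2 by field_simp; norm_num]
      field_simp

lemma lintegral_inv_pow_four_le {ζ : ℂ} {d : ℝ} (hd : 0 < d) {D : Set ℂ}
    (hD : MeasurableSet D) (h : ∀ w ∈ D, d < ‖w - ζ‖) :
    ∫⁻ w in D, ‖((w - ζ) ^ 2)⁻¹‖ₑ ^ 2 ≤ ENNReal.ofReal (Real.pi / d ^ 2) := by
  set F : ℝ → ℝ := (Ioi d).indicator (fun x => x ^ (-4 : ℝ)) with hF
  have hyF : EqOn (fun y => y * F y) ((Ioi d).indicator (fun x => x ^ (-3 : ℝ))) (Ioi 0) := by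
    intro y (hy0 : 0 < y)
    by_cases hy : y ∈ Ioi d
    · simp only [hF]
      rw [indicator_of_mem hy, indicator_of_mem hy, ← Real.rpow_one_add' hy0.le (by norm_num)]
      norm_num
    · simp only [hF]
      rw [indicator_of_notMem hy, indicator_of_notMem hy, mul_zero]
  have hF0 : ∀ x, 0 ≤ F x := indicator_nonneg fun x hx => Real.rpow_nonneg (hd.trans hx).le _
  have hii : IntegrableOn (fun x : ℝ => x ^ (-3 : ℝ)) (Ioi d) :=
    integrableOn_Ioi_rpow_of_lt (by norm_num) hd
  have hint : Integrable (fun w : ℂ => F ‖w - ζ‖) := by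
    refine Integrable.comp_sub_right (f := fun w : ℂ => F ‖w‖) ?_ ζ
    rw [integrable_fun_norm_addHaar]
    simp only [Complex.finrank_real_complex, Nat.add_one_sub_one, pow_one, smul_eq_mul]
    exact ((integrable_indicator_iff measurableSet_Ioi).2 hii).integrableOn.congr_fun hyF.symm
      measurableSet_Ioi
  calc ∫⁻ w in D, ‖((w - ζ) ^ 2)⁻¹‖ₑ ^ 2 ≤ ∫⁻ w in D, ENNReal.ofReal (F ‖w - ζ‖) := by
        refine setLIntegral_mono' hD fun w hw => ?_
        rw [← ofReal_norm, ← ENNReal.ofReal_pow (norm_nonneg _)]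
        refine ENNReal.ofReal_le_ofReal (le_of_eq ?_)
        rw [hF, indicator_of_mem (show ‖w - ζ‖ ∈ Ioi d from h w hw), norm_inv, norm_pow,
          Real.rpow_neg (norm_nonneg _), show (4 : ℝ) = (4 : ℕ) by norm_num, Real.rpow_natCast]
        ring
    _ ≤ ∫⁻ w, ENNReal.ofReal (F ‖w - ζ‖) := setLIntegral_le_lintegral _ _
    _ = ENNReal.ofReal (∫ w : ℂ, F ‖w - ζ‖) :=
        (ofReal_integral_eq_lintegral_ofReal hint (Eventually.of_forall fun w => hF0 _)).symm
    _ = _ := by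
        congr 1
        have hsub : Ioi d ⊆ Ioi 0 := fun x hx => hd.trans hx
        rw [integral_norm_sub, setIntegral_congr_fun measurableSet_Ioi hyF,
          setIntegral_indicator measurableSet_Ioi, inter_eq_right.2 hsub,
          integral_Ioi_rpow_of_lt (by norm_num) hd]
        rw [show (-3 : ℝ) + 1 = -2 by norm_num, Real.rpow_neg hd.le]
        norm_num
        field_simp

/-- The test function is $(w-\zeta)^{-2}$ with a pole just outside the disc: its value at $z$ has
squared modulus $(2d)^{-4}$, and its squared norm is at most $\pi/d^2$. -/
lemma le_bergmanKernel_unitDisc {z : ℂ} (hz : z ∈ unitDisc) :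
    ENNReal.ofReal (1 / (16 * Real.pi * (1 - ‖z‖) ^ 2)) ≤ bergmanKernel unitDisc z := by
  have hz1 : ‖z‖ < 1 := by simpa [unitDisc] using hz
  set d := 1 - ‖z‖ with hd
  have hd0 : 0 < d := by linarith
  obtain ⟨u, hu, hzu⟩ : ∃ u : ℂ, ‖u‖ = 1 ∧ z = ‖z‖ * u := by
    by_cases h : z = 0
    · exact ⟨1, by simp, by simp [h]⟩
    · have : (‖z‖ : ℂ) ≠ 0 := by simpa
      refine ⟨z / ‖z‖, by simp [h], by field_simp⟩
  -- The pole lies on the ray through $z$, at distance $d$ from the disc and $2d$ from $z$.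
  set ζ : ℂ := ((1 + d : ℝ) : ℂ) * u with hζ
  have hζn : ‖ζ‖ = 1 + d := by
    rw [hζ, norm_mul, hu, norm_real, Real.norm_eq_abs, abs_of_pos (by positivity), mul_one]
  have hzζ : ‖z - ζ‖ = 2 * d := by
    have : z - ζ = ((-(2 * d) : ℝ) : ℂ) * u := by
      rw [hζ, hd]
      nth_rewrite 1 [hzu]
      push_cast
      ring
    rw [this, norm_mul, hu, norm_real, Real.norm_eq_abs, abs_neg, abs_of_pos (by positivity),
      mul_one]
  have hw : ∀ w ∈ unitDisc, d < ‖w - ζ‖ := fun w hw => by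
    have h1 : ‖w‖ < 1 := by simpa [unitDisc] using hw
    have h2 := norm_sub_norm_le ζ w
    rw [norm_sub_rev] at h2
    linarith
  set f : ℂ → ℂ := fun w => ((w - ζ) ^ 2)⁻¹ with hf
  have hne : ∀ w ∈ unitDisc, (w - ζ) ^ 2 ≠ 0 := fun w h =>
    pow_ne_zero _ (norm_pos_iff.1 (hd0.trans (hw w h)))
  have hmeas : MeasurableSet unitDisc := Metric.isOpen_ball.measurableSet
  have hn : eLpNorm f 2 (volume.restrict unitDisc) ^ 2 ≤ ENNReal.ofReal (Real.pi / d ^ 2) := by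
    rw [eLpNorm_two_sq]
    exact lintegral_inv_pow_four_le hd0 hmeas hw
  have hfd : DifferentiableOn ℂ f unitDisc :=
    DifferentiableOn.inv (by fun_prop) hne
  have hmem : f ∈ SqIntHol unitDisc := by
    refine ⟨hfd, hfd.continuousOn.aestronglyMeasurable hmeas, ?_⟩
    have := hn.trans_lt ENNReal.ofReal_lt_top
    by_contra h
    rw [not_lt, top_le_iff] at h
    simp [h] at this
  have hval : ‖f z‖ₑ ^ 2 = ENNReal.ofReal (1 / (2 * d) ^ 4) := by
    rw [← ofReal_norm, ← ENNReal.ofReal_pow (norm_nonneg _), hf]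
    simp only [norm_inv, norm_pow, hzζ]
    congr 1
    rw [one_div, inv_pow, ← pow_mul]
  calc _ = ENNReal.ofReal (1 / (2 * d) ^ 4) / ENNReal.ofReal (Real.pi / d ^ 2) := by
        rw [← ENNReal.ofReal_div_of_pos (by positivity)]
        congr 1
        field_simp
        norm_num
    _ ≤ ‖f z‖ₑ ^ 2 / eLpNorm f 2 (volume.restrict unitDisc) ^ 2 := by
        rw [hval]
        exact ENNReal.div_le_div_left hn _
    _ ≤ _ := le_iSup₂_of_le (f := fun f _ =>
        ‖f z‖ₑ ^ 2 / eLpNorm f 2 (volume.restrict unitDisc) ^ 2) f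
        ⟨hmem, z, hz, inv_ne_zero (hne z hz)⟩ le_rfl

/-! ### Geometry of the holes and convergence of the series -/

/-- The contribution of the `j`-th hole to the bound for the Bergman kernel. -/
noncomputable def holeTerm (p : ℕ → ℂ) (r : ℕ → ℝ) (z : ℂ) (j : ℕ) : ℝ :=
  1 / (‖z - p j‖ ^ 2 * (-Real.log (r j))) + r j ^ 2 / (‖z - p j‖ ^ 2 - r j ^ 2) ^ 2

lemma lt_norm_sub_of_mem_holeDomain {p : ℕ → ℂ} {r : ℕ → ℝ} {z : ℂ} (hz : z ∈ holeDomain p r) (j : ℕ) : r j < ‖z - p j‖ := by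
  by_contra! hle
  exact hz.2 (Or.inl (mem_iUnion.2 ⟨j, by rwa [Metric.mem_closedBall, dist_eq_norm]⟩))

lemma ne_zero_of_mem_holeDomain {p : ℕ → ℂ} {r : ℕ → ℝ} {z : ℂ} (hz : z ∈ holeDomain p r) : z ≠ 0 := fun h0 => hz.2 (Or.inr h0)

lemma norm_lt_one_of_mem_holeDomain {p : ℕ → ℂ} {r : ℕ → ℝ} {z : ℂ} (hz : z ∈ holeDomain p r) : ‖z‖ < 1 := by
  simpa [unitDisc] using hz.1

/-- Radii `r j < s j < t j < 1` and centres `p j` tending to the origin, with disjoint discs of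
radii `t j`, such that the annuli `r j < |z - p j| < s j` are uniformly thick. -/
structure IsHoleSystem (p : ℕ → ℂ) (r s t : ℕ → ℝ) : Prop where
  r_pos : ∀ j, 0 < r j
  r_lt_s : ∀ j, r j < s j
  s_lt_t : ∀ j, s j < t j
  disj : ∀ j k, j ≠ k → Disjoint (Metric.closedBall (p j) (t j)) (Metric.closedBall (p k) (t k))
  tendsto : Tendsto p atTop (𝓝 0)
  t_lt_one : ∀ j, t j < 1
  log_le : ∀ j, Real.log (r j) ≤ 2 * Real.log (s j)
  tendsto_ratio : Tendsto (fun j => s j / t j) atTop (𝓝 0)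
  summable : Summable fun j => -1 / Real.log (r j)

/-- The metric conditions satisfied by all holes close to the origin. -/
structure IsSmallHole (p : ℕ → ℂ) (r s t : ℕ → ℝ) (j : ℕ) : Prop where
  norm_lt : ‖p j‖ < 1 / 4
  s_le : 4 * s j ≤ t j
  r_le : 16 * r j ≤ s j
  log_le : -Real.log (r j) ≤ 4 * Real.log (s j / (4 * r j))

namespace IsHoleSystem

variable {p : ℕ → ℂ} {r s t : ℕ → ℝ} (h : IsHoleSystem p r s t)

include h

lemma s_pos (j : ℕ) : 0 < s j := (h.r_pos j).trans (h.r_lt_s j)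

lemma t_pos (j : ℕ) : 0 < t j := (h.s_pos j).trans (h.s_lt_t j)

lemma r_lt_t (j : ℕ) : r j < t j := (h.r_lt_s j).trans (h.s_lt_t j)

lemma r_lt_one (j : ℕ) : r j < 1 := (h.r_lt_t j).trans (h.t_lt_one j)

lemma log_neg (j : ℕ) : Real.log (r j) < 0 := Real.log_neg (h.r_pos j) (h.r_lt_one j)

/-- Otherwise the origin is interior to the $j$-th disc, which then contains later centres since
these tend to 0; this contradicts disjointness. -/
lemma t_le_norm (j : ℕ) : t j ≤ ‖p j‖ := by
  by_contra! hlt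
  have h1 : ∀ᶠ k in atTop, p k ∈ Metric.ball (p j) (t j) :=
    h.tendsto.eventually (Metric.isOpen_ball.mem_nhds (by simpa using hlt))
  obtain ⟨k, hk, hkj⟩ := (h1.and (eventually_gt_atTop j)).exists
  exact disjoint_left.1 (h.disj j k hkj.ne) (Metric.ball_subset_closedBall hk)
    (Metric.mem_closedBall_self (h.t_pos k).le)

lemma r_lt_norm (j : ℕ) : r j < ‖p j‖ := (h.r_lt_t j).trans_le (h.t_le_norm j)

lemma tendsto_norm : Tendsto (fun j => ‖p j‖) atTop (𝓝 0) := by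
  simpa using h.tendsto.norm

lemma tendsto_r : Tendsto r atTop (𝓝 0) :=
  squeeze_zero (fun j => (h.r_pos j).le) (fun j => (h.r_lt_norm j).le) h.tendsto_norm

lemma eventually_isSmallHole : ∀ᶠ j in atTop, IsSmallHole p r s t j := by
  filter_upwards [h.tendsto_norm.eventually_lt_const (show (0 : ℝ) < 1 / 4 by norm_num),
    h.tendsto_ratio.eventually_lt_const (show (0 : ℝ) < 1 / 4 by norm_num),
    h.tendsto_r.eventually_lt_const (show (0 : ℝ) < 1 / 256 by norm_num)] with j h1 h2 h3
  have hr := h.r_pos j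
  have hs := h.s_pos j
  have hsq : r j ≤ s j ^ 2 := by
    have := h.log_le j
    rw [show 2 * Real.log (s j) = Real.log (s j ^ 2) by simp [Real.log_pow]] at this
    exact (Real.log_le_log_iff hr (by positivity)).1 this
  refine ⟨h1, ?_, ?_, ?_⟩
  · rw [div_lt_iff₀ (h.t_pos j)] at h2
    linarith
  · nlinarith
  -- From $r\le s^2$ one gets $\log(s/4r)\ge -\frac12\log r-\log 4$, and $r<1/256=4^{-4}$ bounds
  -- $\log 4$ by $-\frac14\log r$.
  · have h4 : Real.log (r j) ≤ -(2 * Real.log 16) := by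
      have : Real.log (r j) ≤ Real.log (1 / 256) := Real.log_le_log hr h3.le
      rwa [show (1 / 256 : ℝ) = ((16 : ℝ) ^ 2)⁻¹ by norm_num, Real.log_inv, Real.log_pow] at this
    have h5 : Real.log 16 = 2 * Real.log 4 := by
      rw [show (16 : ℝ) = 4 ^ 2 by norm_num, Real.log_pow]; norm_num
    rw [Real.log_div hs.ne' (by positivity), Real.log_mul (by norm_num) hr.ne']
    linarith [h.log_le j]

/-- The holes accumulate only at the origin. Hence the domain is open although infinitely many
closed discs are removed. -/
lemma notMem_closedBall {w : ℂ} (hw : w ≠ 0) :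
    ∃ N, ∀ j ≥ N, ∀ x, ‖w‖ / 2 < ‖x‖ → x ∉ Metric.closedBall (p j) (r j) := by
  have hw' : 0 < ‖w‖ / 4 := by positivity
  obtain ⟨N, hN⟩ := eventually_atTop.1 (h.tendsto_norm.eventually_lt_const hw')
  refine ⟨N, fun j hj x hx hxj => ?_⟩
  rw [Metric.mem_closedBall, dist_eq_norm] at hxj
  have h1 := norm_sub_norm_le x (p j)
  have h2 := hN j hj
  have h3 := h.r_lt_norm j
  linarith

lemma isOpen_holeDomain : IsOpen (holeDomain p r) := by
  rw [isOpen_iff_mem_nhds]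
  intro z hz
  have hz0 : z ≠ 0 := fun h0 => hz.2 (Or.inr h0)
  obtain ⟨N, hN⟩ := h.notMem_closedBall hz0
  have h1 : ∀ᶠ w in 𝓝 z, w ∈ unitDisc := Metric.isOpen_ball.mem_nhds hz.1
  have h2 : ∀ᶠ w in 𝓝 z, ∀ j ∈ Finset.range N, w ∉ Metric.closedBall (p j) (r j) := by
    rw [Filter.eventually_all_finset]
    exact fun j _ => Metric.isClosed_closedBall.isOpen_compl.mem_nhds fun hj =>
      hz.2 (Or.inl (mem_iUnion.2 ⟨j, hj⟩))
  have h3 : ∀ᶠ w in 𝓝 z, ‖z‖ / 2 < ‖w‖ :=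
    continuousAt_const.eventually_lt continuous_norm.continuousAt
      (half_lt_self (norm_pos_iff.2 hz0))
  filter_upwards [h1, h2, h3] with w hw1 hw2 hw3
  refine ⟨hw1, ?_⟩
  rintro (hw | hw)
  · obtain ⟨j, hj⟩ := mem_iUnion.1 hw
    by_cases hjN : j < N
    · exact hw2 j (Finset.mem_range.2 hjN) hj
    · exact hN j (not_lt.1 hjN) w hw3 hj
  · have := norm_nonneg z
    rw [mem_singleton_iff.1 hw, norm_zero] at hw3
    linarith

lemma summand_nonneg (z : ℂ) (j : ℕ) : 0 ≤ 1 / (‖z - p j‖ ^ 2 * (-Real.log (r j))) := by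
  have := h.log_neg j
  have : 0 ≤ -Real.log (r j) := by linarith
  positivity

lemma holeTerm_nonneg (z : ℂ) (j : ℕ) : 0 ≤ holeTerm p r z j := by
  have := h.summand_nonneg z j
  unfold holeTerm
  positivity

/-- For large $j$ the distance $|z-z_j|$ is comparable to $|z|$ and dominates $r_j$, so both parts
of the term are dominated by a multiple of $-1/\log r_j$. -/
lemma summable_holeTerm {z : ℂ} (hz : z ≠ 0) : Summable (holeTerm p r z) := by
  have hz' : 0 < ‖z‖ := norm_pos_iff.2 hz
  refine Summable.of_norm_bounded_eventually_nat
    (g := fun j => (4 / ‖z‖ ^ 2 + 64 / ‖z‖ ^ 4) * (-1 / Real.log (r j)))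
    (h.summable.mul_left _) ?_
  filter_upwards [h.tendsto_norm.eventually_lt_const (show 0 < ‖z‖ / 4 by positivity)] with j hj
  have hr := h.r_pos j
  have hrn := h.r_lt_norm j
  have hl := h.log_neg j
  have hδ : ‖z‖ * (3 / 4) ≤ ‖z - p j‖ := by linarith [norm_sub_norm_le z (p j)]
  have hl' : 0 < -Real.log (r j) := by linarith
  rw [Real.norm_of_nonneg (h.holeTerm_nonneg z j), holeTerm, add_mul]
  -- Follows from $\log x\le x-1$ at $x=1/r_j$.
  have hrl : r j ^ 2 ≤ -1 / Real.log (r j) := by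
    have h1 : -Real.log (r j) ≤ (r j)⁻¹ := by
      have := Real.log_le_sub_one_of_pos (inv_pos.2 hr)
      rw [Real.log_inv] at this
      linarith
    have h2 : r j ≤ (-Real.log (r j))⁻¹ := by
      rw [le_inv_comm₀ hr hl']; exact h1
    rw [show -1 / Real.log (r j) = (-Real.log (r j))⁻¹ by rw [inv_neg, neg_div, one_div]]
    refine le_trans ?_ h2
    nlinarith [h.r_lt_one j]
  refine add_le_add ?_ ?_
  · rw [show -1 / Real.log (r j) = 1 / (-Real.log (r j)) by rw [one_div, inv_neg, neg_div, one_div],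
      div_mul_div_comm, mul_one,
      div_le_div_iff₀ (mul_pos (pow_pos (lt_of_lt_of_le (by positivity) hδ) 2) hl') (by positivity)]
    have : ‖z‖ ^ 2 ≤ 4 * ‖z - p j‖ ^ 2 := by nlinarith
    nlinarith
  · have h1 : ‖z‖ ^ 2 / 8 ≤ ‖z - p j‖ ^ 2 - r j ^ 2 := by nlinarith
    have h2 : (‖z‖ ^ 2 / 8) ^ 2 ≤ (‖z - p j‖ ^ 2 - r j ^ 2) ^ 2 :=
      pow_le_pow_left₀ (by positivity) h1 2
    calc r j ^ 2 / (‖z - p j‖ ^ 2 - r j ^ 2) ^ 2 ≤ r j ^ 2 / (‖z‖ ^ 2 / 8) ^ 2 := by gcongr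
      _ = 64 / ‖z‖ ^ 4 * r j ^ 2 := by field_simp; norm_num
      _ ≤ _ := by gcongr

lemma holeTerm_le_tsum {z : ℂ} (hz : z ≠ 0) (j : ℕ) :
    holeTerm p r z j ≤ ∑' j, holeTerm p r z j :=
  (h.summable_holeTerm hz).le_tsum j fun i _ => h.holeTerm_nonneg z i

/-- Factor $|z-z_j|^2-r_j^2$ as sum times difference: the second part of the term controls the
inverse square of the distance to the hole. -/
lemma inv_sq_le_holeTerm {z : ℂ} (hz : z ∈ holeDomain p r) (j : ℕ) {R : ℝ}
    (hR : ‖z - p j‖ + r j ≤ R) :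
    1 / (‖z - p j‖ - r j) ^ 2 ≤ R ^ 2 / r j ^ 2 * holeTerm p r z j := by
  have hr := h.r_pos j
  have hδ := lt_norm_sub_of_mem_holeDomain hz j
  have hd : 0 < ‖z - p j‖ - r j := by linarith
  have hd' : 0 < ‖z - p j‖ + r j := by linarith
  have h1 : r j ^ 2 / (‖z - p j‖ ^ 2 - r j ^ 2) ^ 2 ≤ holeTerm p r z j := by
    have := h.summand_nonneg z j
    unfold holeTerm
    linarith
  calc 1 / (‖z - p j‖ - r j) ^ 2
      = (‖z - p j‖ + r j) ^ 2 / r j ^ 2 * (r j ^ 2 / (‖z - p j‖ ^ 2 - r j ^ 2) ^ 2) := by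
        rw [show ‖z - p j‖ ^ 2 - r j ^ 2 = (‖z - p j‖ + r j) * (‖z - p j‖ - r j) by ring]
        field_simp
    _ ≤ R ^ 2 / r j ^ 2 * holeTerm p r z j := by gcongr

/-- The bound $t_j\le|z_j|$ keeps the origin out, $|z_j|<1/4$ keeps the annulus inside $E$, and
disjointness keeps the other holes out. -/
lemma annulus_subset {j : ℕ} (hj : IsSmallHole p r s t j) {w : ℂ} (h1 : r j < ‖w - p j‖)
    (h2 : ‖w - p j‖ < t j) : w ∈ holeDomain p r := by
  have htn := h.t_le_norm j
  refine ⟨?_, ?_⟩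
  · have := norm_sub_norm_le w (p j)
    have := hj.norm_lt
    have := h.s_pos j
    by_cases ht : t j ≤ 1 / 4
    · simp only [unitDisc, Metric.mem_ball, dist_zero_right]
      linarith
    · linarith
  · rintro (hw | hw)
    · obtain ⟨k, hk⟩ := mem_iUnion.1 hw
      by_cases hkj : j = k
      · subst hkj
        rw [Metric.mem_closedBall, dist_eq_norm] at hk
        linarith
      · exact disjoint_left.1 (h.disj j k hkj)
          (by rw [Metric.mem_closedBall, dist_eq_norm]; exact h2.le)
          (Metric.closedBall_subset_closedBall (h.r_lt_t k).le hk)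
    · rw [mem_singleton_iff.1 hw, zero_sub, norm_neg] at h2
      linarith

end IsHoleSystem

/-! ### The estimate away from the origin -/

lemma ofReal_le_mul_bergmanKernel_unitDisc {z : ℂ} (hz : z ∈ unitDisc) {c : ℝ} (hc : 0 ≤ c) :
    ENNReal.ofReal (c / (1 - ‖z‖) ^ 2) ≤
      ENNReal.ofReal (16 * Real.pi * c) * bergmanKernel unitDisc z := by
  have hz1 : ‖z‖ < 1 := by simpa [unitDisc] using hz
  have : 0 < 1 - ‖z‖ := by linarith
  refine le_trans (le_of_eq ?_) (mul_le_mul_right (le_bergmanKernel_unitDisc hz) _)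
  rw [← ENNReal.ofReal_mul (by positivity)]
  congr 1
  field_simp

/-- Since $1-|z|\le 1$, the kernel of $E$ is bounded below, so it absorbs every bounded error. -/
lemma ofReal_le_mul_bergmanKernel_unitDisc' {z : ℂ} (hz : z ∈ unitDisc) {c : ℝ} (hc : 0 ≤ c) :
    ENNReal.ofReal c ≤ ENNReal.ofReal (16 * Real.pi * c) * bergmanKernel unitDisc z := by
  have hz1 : ‖z‖ < 1 := by simpa [unitDisc] using hz
  refine le_trans (ENNReal.ofReal_le_ofReal ?_) (ofReal_le_mul_bergmanKernel_unitDisc hz hc)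
  have h0 := norm_nonneg z
  rw [le_div_iff₀ (by nlinarith)]
  have : (1 - ‖z‖) ^ 2 ≤ 1 := by nlinarith
  nlinarith

namespace IsHoleSystem

variable {p : ℕ → ℂ} {r s t : ℕ → ℝ} (h : IsHoleSystem p r s t)

include h

/-- The bound for the Bergman kernel away from the origin. -/
lemma exists_bound_of_le_norm {δ : ℝ} (hδ : 0 < δ) : ∃ C : ℝ, 0 < C ∧ ∀ z ∈ holeDomain p r,
    δ ≤ ‖z‖ → bergmanKernel (holeDomain p r) z ≤ ENNReal.ofReal C *
      (bergmanKernel unitDisc z + ENNReal.ofReal (∑' j, holeTerm p r z j)) := by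
  obtain ⟨C₀, hC₀, hK⟩ := exists_bergmanKernel_le_of_ball
  obtain ⟨N, hN⟩ := eventually_atTop.1
    (h.tendsto_norm.eventually_lt_const (show 0 < δ / 4 by positivity))
  have hsum : ∀ j ∈ Finset.range N, 0 ≤ 25 / r j ^ 2 := fun j _ => by positivity
  have hsum0 := Finset.sum_nonneg hsum
  set C₁ := ∑ j ∈ Finset.range N, 25 / r j ^ 2 with hC₁
  refine ⟨16 * Real.pi * (C₀ + 4 * C₀ / δ ^ 2) + C₀ * C₁, by positivity, fun z hz hzδ => ?_⟩
  have hclosed : IsClosed (holeDomain p r)ᶜ := h.isOpen_holeDomain.isClosed_compl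
  -- The nearest point $y$ of the complement lies outside $E$, in one of the finitely many holes
  -- with index below $N$, or within $\delta/2$ of the origin. In the last case the distance is at
  -- least $\delta/2$.
  obtain ⟨y, hy, hyd⟩ := hclosed.exists_infDist_eq_dist ⟨0, fun h0 => ne_zero_of_mem_holeDomain h0 rfl⟩ z
  have hd : 0 < dist z y := dist_pos.2 fun hzy => hy (hzy ▸ hz)
  have hball : Metric.ball z (dist z y) ⊆ holeDomain p r := fun w hw => by
    by_contra hwD
    have := Metric.infDist_le_dist_of_mem (x := z) (show w ∈ (holeDomain p r)ᶜ from hwD)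
    rw [Metric.mem_ball, dist_comm] at hw
    linarith
  have hzE : z ∈ unitDisc := hz.1
  have hz1 := norm_lt_one_of_mem_holeDomain hz
  have hzn := norm_nonneg z
  have hKd := hK _ z _ hd hball
  rw [dist_eq_norm] at hd hKd
  have h1 : ∀ c : ℝ, 0 ≤ c → c ≤ C₀ + 4 * C₀ / δ ^ 2 → ENNReal.ofReal (16 * Real.pi * c) *
      bergmanKernel unitDisc z ≤ ENNReal.ofReal (16 * Real.pi * (C₀ + 4 * C₀ / δ ^ 2) + C₀ * C₁) *
      (bergmanKernel unitDisc z + ENNReal.ofReal (∑' j, holeTerm p r z j)) := fun c hc0 hc => by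
    refine mul_le_mul' (ENNReal.ofReal_le_ofReal ?_) le_self_add
    have : 0 ≤ C₀ * C₁ := by positivity
    have := mul_le_mul_of_nonneg_left hc (show 0 ≤ 16 * Real.pi by positivity)
    linarith
  have h2 : δ / 2 ≤ ‖z - y‖ → bergmanKernel (holeDomain p r) z ≤
      ENNReal.ofReal (16 * Real.pi * (C₀ + 4 * C₀ / δ ^ 2) + C₀ * C₁) *
      (bergmanKernel unitDisc z + ENNReal.ofReal (∑' j, holeTerm p r z j)) := fun hle => by
    refine hKd.trans ((ENNReal.ofReal_le_ofReal ?_).trans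
      ((ofReal_le_mul_bergmanKernel_unitDisc' hzE (c := 4 * C₀ / δ ^ 2) (by positivity)).trans
      (h1 _ (by positivity) (by linarith))))
    calc C₀ / ‖z - y‖ ^ 2 ≤ C₀ / (δ / 2) ^ 2 := by gcongr
      _ = _ := by field_simp; norm_num
  by_cases hyE : y ∈ unitDisc
  · have hy' : y ∈ (⋃ j, Metric.closedBall (p j) (r j)) ∪ {0} := by
      by_contra hc
      exact hy ⟨hyE, hc⟩
    rcases hy' with hy' | hy'
    · obtain ⟨j, hj⟩ := mem_iUnion.1 hy'
      rw [Metric.mem_closedBall, dist_eq_norm] at hj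
      by_cases hjN : j < N
      · have hr := h.r_pos j
        have hgap := lt_norm_sub_of_mem_holeDomain hz j
        have hle : ‖z - p j‖ - r j ≤ ‖z - y‖ := by
          have := norm_sub_le_norm_sub_add_norm_sub z y (p j)
          linarith
        have hpj : ‖p j‖ ≤ 1 + r j := by
          have hy1 : ‖y‖ < 1 := by simpa [unitDisc] using hyE
          have := norm_sub_norm_le (p j) y
          rw [norm_sub_rev] at this
          linarith
        -- A hole meeting $E$ has $|z_j|\le 1+r_j<2$. The square of this 5 is the 25 in `C₁`.
        have hR : ‖z - p j‖ + r j ≤ 5 := by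
          have := norm_sub_le z (p j)
          have := h.r_lt_one j
          linarith
        have hX := h.holeTerm_nonneg z j
        have hXS := h.holeTerm_le_tsum (ne_zero_of_mem_holeDomain hz) j
        have hgap' : 0 < ‖z - p j‖ - r j := by linarith
        have hC : 25 / r j ^ 2 ≤ C₁ := Finset.single_le_sum hsum (Finset.mem_range.2 hjN)
        have hmain : C₀ / ‖z - y‖ ^ 2 ≤ C₀ * C₁ * ∑' j, holeTerm p r z j := by
          have h3 := inv_sq_le_holeTerm h hz j hR
          norm_num at h3
          calc C₀ / ‖z - y‖ ^ 2 ≤ C₀ / (‖z - p j‖ - r j) ^ 2 := by gcongr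
            _ = C₀ * ((‖z - p j‖ - r j) ^ 2)⁻¹ := div_eq_mul_inv _ _
            _ ≤ C₀ * (25 / r j ^ 2 * holeTerm p r z j) := by gcongr
            _ ≤ C₀ * (C₁ * ∑' j, holeTerm p r z j) := by gcongr
            _ = _ := by ring
        refine hKd.trans ((ENNReal.ofReal_le_ofReal hmain).trans ?_)
        rw [ENNReal.ofReal_mul (by positivity)]
        refine mul_le_mul' (ENNReal.ofReal_le_ofReal ?_) le_add_self
        have : 0 ≤ 16 * Real.pi * (C₀ + 4 * C₀ / δ ^ 2) := by positivity
        linarith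
      · refine h2 ?_
        have h3 := hN j (not_lt.1 hjN)
        have h4 := h.r_lt_norm j
        have h5 := norm_sub_norm_le z y
        have h6 := norm_sub_norm_le y (p j)
        linarith
    · refine h2 ?_
      rw [mem_singleton_iff.1 hy', sub_zero]
      linarith
  · have hy1 : 1 ≤ ‖y‖ := by simpa [unitDisc] using hyE
    have hle : 1 - ‖z‖ ≤ ‖z - y‖ := by
      have := norm_sub_norm_le y z
      rw [norm_sub_rev] at this
      linarith
    have hpos : 0 < 1 - ‖z‖ := by linarith
    refine hKd.trans ((ENNReal.ofReal_le_ofReal ?_).trans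
      ((ofReal_le_mul_bergmanKernel_unitDisc hzE hC₀.le).trans
      (h1 _ hC₀.le (by have : 0 ≤ 4 * C₀ / δ ^ 2 := by positivity
                       linarith))))
    gcongr

end IsHoleSystem

/-! ### Next to a single hole -/

lemma enorm_add_sq_le (x y : ℂ) : ‖x + y‖ₑ ^ 2 ≤ 2 * (‖x‖ₑ ^ 2 + ‖y‖ₑ ^ 2) := by
  simp only [← ofReal_norm, ← ENNReal.ofReal_pow (norm_nonneg _)]
  rw [← ENNReal.ofReal_add (by positivity) (by positivity),
    show (2 : ENNReal) = ENNReal.ofReal 2 by simp, ← ENNReal.ofReal_mul (by norm_num)]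
  refine ENNReal.ofReal_le_ofReal ?_
  have := norm_add_le x y
  nlinarith [norm_nonneg (x + y), norm_nonneg x, norm_nonneg y, sq_nonneg (‖x‖ - ‖y‖)]

lemma le_norm_of_dbar_bump_ne_zero {c : ℂ} {a b : ℝ} {w : ℂ} (hw : dbar (bump c a b) w ≠ 0) :
    a ≤ ‖w - c‖ := by
  by_contra! hlt
  exact hw (dbar_bump_of_lt hlt)

lemma norm_le_of_dbar_bump_ne_zero {c : ℂ} {a b : ℝ} (ha : 0 < a) (hab : a < b) {w : ℂ}
    (hw : dbar (bump c a b) w ≠ 0) : ‖w - c‖ ≤ b := by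
  by_contra! hlt
  exact hw (dbar_bump_of_gt ha hab hlt)

namespace IsHoleSystem

variable {p : ℕ → ℂ} {r s t : ℕ → ℝ} (h : IsHoleSystem p r s t)

include h

/-- The bound for the Bergman kernel next to the boundary of a small hole. -/
lemma exists_bound_of_near : ∃ C : ℝ, 0 < C ∧ ∀ z ∈ holeDomain p r, ∀ j,
    IsSmallHole p r s t j → ‖z - p j‖ ≤ 4 * r j →
    bergmanKernel (holeDomain p r) z ≤ ENNReal.ofReal C *
      (bergmanKernel unitDisc z + ENNReal.ofReal (∑' j, holeTerm p r z j)) := by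
  obtain ⟨C₀, hC₀, hK⟩ := exists_bergmanKernel_le_of_ball
  refine ⟨25 * C₀, by positivity, fun z hz j hj hle => ?_⟩
  have hr := h.r_pos j
  have hgap := lt_norm_sub_of_mem_holeDomain hz j
  have hgap' : 0 < ‖z - p j‖ - r j := by linarith
  have hball : Metric.ball z (‖z - p j‖ - r j) ⊆ holeDomain p r := fun w hw => by
    rw [Metric.mem_ball, dist_eq_norm] at hw
    refine h.annulus_subset hj ?_ ?_
    · have := norm_sub_le_norm_sub_add_norm_sub z w (p j)
      rw [norm_sub_rev z w] at this
      linarith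
    · have := norm_sub_le_norm_sub_add_norm_sub w z (p j)
      linarith [hj.r_le, hj.s_le]
  -- With $|z-z_j|\le 4r_j$ the comparison factor is $5^2$, the same for all holes.
  have h3 := h.inv_sq_le_holeTerm hz j (R := 5 * r j) (by linarith)
  rw [show (5 * r j) ^ 2 / r j ^ 2 = 25 by field_simp; norm_num] at h3
  have hmain : C₀ / (‖z - p j‖ - r j) ^ 2 ≤ 25 * C₀ * ∑' j, holeTerm p r z j :=
    calc C₀ / (‖z - p j‖ - r j) ^ 2 = C₀ * (1 / (‖z - p j‖ - r j) ^ 2) := by ring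
      _ ≤ C₀ * (25 * holeTerm p r z j) := by gcongr
      _ = 25 * C₀ * holeTerm p r z j := by ring
      _ ≤ _ := by
        gcongr
        exact h.holeTerm_le_tsum (ne_zero_of_mem_holeDomain hz) j
  refine (hK _ z _ hgap' hball).trans ((ENNReal.ofReal_le_ofReal hmain).trans ?_)
  rw [ENNReal.ofReal_mul (by positivity)]
  exact mul_le_mul' le_rfl le_add_self

lemma integrable_mul_dbar_of_annulus {j : ℕ} (hj : IsSmallHole p r s t j) {g : ℂ → ℂ}
    (hg : ContinuousOn g (holeDomain p r)) {a b : ℝ} (ha : r j < a) (hab : a < b) (hb : b < s j) :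
    Integrable fun w => g w * dbar (bump (p j) a b) w := by
  have ha0 := (h.r_pos j).trans ha
  refine integrable_mul_dbar h.isOpen_holeDomain hg (contDiff_bump ha0 hab)
    (hasCompactSupport_bump ha0 hab) fun w hw => ?_
  by_cases h1 : ‖w - p j‖ < a
  · exact dbar_eventuallyEq_zero (bump_eventuallyEq_one h1)
  · refine dbar_eventuallyEq_zero (bump_eventuallyEq_zero ha0 hab ?_)
    by_contra! h2
    exact hw (h.annulus_subset hj (by linarith) (by linarith [h.s_lt_t j]))

/-- The integral of a holomorphic function against `∂̄` of a cutoff in the annulus around a hole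
does not depend on the cutoff. -/
lemma integral_mul_dbar_bump_eq {j : ℕ} (hj : IsSmallHole p r s t j) {f : ℂ → ℂ}
    (hf : DifferentiableOn ℂ f (holeDomain p r)) {a b a' b' : ℝ} (ha : r j < a) (hab : a < b)
    (hb : b < s j) (ha' : r j < a') (hab' : a' < b') (hb' : b' < s j) :
    ∫ w, f w * dbar (bump (p j) a b) w = ∫ w, f w * dbar (bump (p j) a' b') w := by
  have ha0 := (h.r_pos j).trans ha
  have ha0' := (h.r_pos j).trans ha'
  have hd := contDiff_bump (c := p j) ha0 hab
  have hd' := contDiff_bump (c := p j) ha0' hab'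
  rw [← sub_eq_zero, ← integral_sub (h.integrable_mul_dbar_of_annulus hj hf.continuousOn ha hab hb)
    (h.integrable_mul_dbar_of_annulus hj hf.continuousOn ha' hab' hb')]
  rw [← integral_mul_dbar_eq_zero h.isOpen_holeDomain hf (hd.sub hd')
    ((hasCompactSupport_bump ha0 hab).sub (hasCompactSupport_bump ha0' hab')) fun w hw => ?_]
  · congr 1 with w
    rw [dbar_sub (hd.differentiable one_ne_zero w) (hd'.differentiable one_ne_zero w)]
    ring
  · by_cases h1 : ‖w - p j‖ ≤ r j
    · filter_upwards [bump_eventuallyEq_one (b := b) (h1.trans_lt ha),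
        bump_eventuallyEq_one (b := b') (h1.trans_lt ha')] with x hx hx'
      simp [hx, hx']
    · have h2 : s j ≤ ‖w - p j‖ := by
        by_contra! h2
        exact hw (h.annulus_subset hj (by linarith) (by linarith [h.s_lt_t j]))
      filter_upwards [bump_eventuallyEq_zero ha0 hab (hb.trans_le h2),
        bump_eventuallyEq_zero ha0' hab' (hb'.trans_le h2)] with x hx hx'
      simp [hx, hx']

end IsHoleSystem

/-! ### Local kernels at one hole -/

/-- `IsHoleKernel p r s z j a b q C` says that the cutoff with radii `a` and `b` around the `j`-th
hole avoids `z`, and that `q` is a correction annihilating holomorphic functions which brings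
the square norm of the Cauchy–Pompeiu kernel of the cutoff below `C * holeTerm p r z j`. -/
structure IsHoleKernel (p : ℕ → ℂ) (r s : ℕ → ℝ) (z : ℂ) (C : ℝ) (j : ℕ) (a b : ℝ)
    (q : ℂ → ℂ) : Prop where
  r_lt : r j < a
  lt : a < b
  lt_s : b < s j
  lt_norm : b < ‖z - p j‖
  continuous : Continuous q
  eq_zero : ∀ w, ‖w - p j‖ ∉ Ioo (r j) (s j) → q w = 0
  near : s j ≤ ‖z - p j‖ → q = 0
  integrable : ∀ f, DifferentiableOn ℂ f (holeDomain p r) → Integrable fun w => f w * q w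
  integral : ∀ f, DifferentiableOn ℂ f (holeDomain p r) → ∫ w, f w * q w = 0
  bound : ∫⁻ w, ‖dbar (bump (p j) a b) w / (w - z) + q w‖ₑ ^ 2 ≤
    ENNReal.ofReal (C * holeTerm p r z j)

namespace IsHoleSystem

variable {p : ℕ → ℂ} {r s t : ℕ → ℝ} (h : IsHoleSystem p r s t)

include h

/-- The whole annulus is available, so no correction is needed: on the support of the cutoff
$|w-z|\ge|z-z_j|/2$, and the logarithmic width is at least $-\frac14\log r_j$. -/
lemma exists_holeKernel_of_far {C₀ : ℝ} (hC₀ : 0 < C₀)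
    (hb : ∀ (c : ℂ) (a b B : ℝ) (k : ℂ → ℂ), 0 < a → a < b → 0 ≤ B →
      (∀ w, ‖k w‖ ≤ B * ‖dbar (bump c a b) w‖) →
      ∫⁻ w, ‖k w‖ₑ ^ 2 ≤ ENNReal.ofReal (C₀ * B ^ 2 / Real.log (b / a)))
    {z : ℂ} {j : ℕ} (hj : IsSmallHole p r s t j) (hs : s j ≤ ‖z - p j‖) :
    IsHoleKernel p r s z (16 * C₀) j (2 * r j) (s j / 2) 0 := by
  have hr := h.r_pos j
  have hrs := hj.r_le
  have hl := h.log_neg j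
  have hδ : 0 < ‖z - p j‖ := (h.s_pos j).trans_le hs
  have ha : 0 < 2 * r j := by positivity
  have hab : 2 * r j < s j / 2 := by linarith
  refine ⟨by linarith, hab, by linarith, by linarith, continuous_const, fun _ _ => rfl,
    fun _ => rfl, by simp, by simp, ?_⟩
  refine (hb (p j) (2 * r j) (s j / 2) (2 / ‖z - p j‖) _ ha hab (by positivity)
    fun w => ?_).trans (ENNReal.ofReal_le_ofReal ?_)
  · rw [Pi.zero_apply, add_zero, norm_div]
    by_cases hw : dbar (bump (p j) (2 * r j) (s j / 2)) w = 0
    · simp [hw]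
    · have h1 := norm_le_of_dbar_bump_ne_zero ha hab hw
      have h2 : ‖z - p j‖ / 2 ≤ ‖w - z‖ := by
        have := norm_sub_le_norm_sub_add_norm_sub z w (p j)
        rw [norm_sub_rev z w] at this
        linarith
      calc _ ≤ ‖dbar (bump (p j) (2 * r j) (s j / 2)) w‖ / (‖z - p j‖ / 2) := by gcongr
        _ = _ := by field_simp
  · have hlog := hj.log_le
    rw [show s j / (4 * r j) = s j / 2 / (2 * r j) by field_simp; norm_num] at hlog
    have hL : 0 < -Real.log (r j) / 4 := by linarith
    calc C₀ * (2 / ‖z - p j‖) ^ 2 / Real.log (s j / 2 / (2 * r j))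
        ≤ C₀ * (2 / ‖z - p j‖) ^ 2 / (-Real.log (r j) / 4) := by gcongr; linarith
      _ = 16 * C₀ * (1 / (‖z - p j‖ ^ 2 * (-Real.log (r j)))) := by
        have : Real.log (r j) ≠ 0 := hl.ne
        field_simp
        norm_num
      _ ≤ _ := by
        gcongr
        unfold holeTerm
        have : 0 ≤ r j ^ 2 / (‖z - p j‖ ^ 2 - r j ^ 2) ^ 2 := by positivity
        linarith

/-- With $c=z_j$, the narrow cutoff $\beta$ and the wide cutoff $\beta'$ have the same integral
against holomorphic functions, so their difference times $(c-z)^{-1}$ is a legitimate correction.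
The corrected kernel is $\frac{\bar\partial\beta'}{c-z}+\bar\partial\beta\,\frac{c-w}{(w-z)(c-z)}$.
Its first summand is cheap because $\beta'$ is wide, its second because $|w-c|\le 2r_j$ on the
support of $\bar\partial\beta$. -/
lemma exists_holeKernel_of_near {C₀ : ℝ} (hC₀ : 0 < C₀)
    (hb : ∀ (c : ℂ) (a b B : ℝ) (k : ℂ → ℂ), 0 < a → a < b → 0 ≤ B →
      (∀ w, ‖k w‖ ≤ B * ‖dbar (bump c a b) w‖) →
      ∫⁻ w, ‖k w‖ₑ ^ 2 ≤ ENNReal.ofReal (C₀ * B ^ 2 / Real.log (b / a)))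
    {z : ℂ} {j : ℕ} (hj : IsSmallHole p r s t j) (hs : ‖z - p j‖ < s j)
    (hz : 4 * r j < ‖z - p j‖) :
    ∃ q, IsHoleKernel p r s z (2 * (4 * C₀ + 16 * C₀ / Real.log (4 / 3))) j
      (3 / 2 * r j) (2 * r j) q := by
  have hr := h.r_pos j
  have hrs := hj.r_le
  have hl := h.log_neg j
  have hδ : 0 < ‖z - p j‖ := by linarith
  have ha : 0 < 3 / 2 * r j := by positivity
  have hab : 3 / 2 * r j < 2 * r j := by linarith
  have ha' : 0 < 2 * r j := by positivity
  have hab' : 2 * r j < s j / 2 := by linarith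
  set c := p j with hc
  set β := bump c (3 / 2 * r j) (2 * r j) with hβ
  set β' := bump c (2 * r j) (s j / 2) with hβ'
  have hcz : c - z ≠ 0 := by
    rw [← norm_pos_iff, norm_sub_rev]; exact hδ
  have hβi : ∀ f, DifferentiableOn ℂ f (holeDomain p r) → Integrable fun w => f w * dbar β w :=
    fun f hf => h.integrable_mul_dbar_of_annulus hj hf.continuousOn (by linarith) hab (by linarith)
  have hβi' : ∀ f, DifferentiableOn ℂ f (holeDomain p r) → Integrable fun w => f w * dbar β' w :=
    fun f hf => h.integrable_mul_dbar_of_annulus hj hf.continuousOn (by linarith) hab' (by linarith)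
  have hq : ∀ (f : ℂ → ℂ), (fun w => f w * ((c - z)⁻¹ * (dbar β' w - dbar β w))) =
      fun w => (c - z)⁻¹ * (f w * dbar β' w - f w * dbar β w) := fun f => by
    ext w
    ring
  refine ⟨fun w => (c - z)⁻¹ * (dbar β' w - dbar β w), by linarith, hab, by linarith,
    by linarith, ?_, fun w hw => ?_, fun h' => absurd hs (not_lt.2 h'), fun f hf => ?_,
    fun f hf => ?_, ?_⟩
  · exact continuous_const.mul ((continuous_dbar_bump ha' hab').sub (continuous_dbar_bump ha hab))
  · rw [mem_Ioo, not_and_or, not_lt, not_lt] at hw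
    rcases hw with hw | hw
    · rw [dbar_bump_of_lt (by linarith), dbar_bump_of_lt (by linarith)]
      simp
    · rw [dbar_bump_of_gt ha' hab' (by linarith), dbar_bump_of_gt ha hab (by linarith)]
      simp
  · rw [hq]
    exact ((hβi' f hf).sub (hβi f hf)).const_mul _
  · rw [hq, integral_const_mul, integral_sub (hβi' f hf) (hβi f hf),
      h.integral_mul_dbar_bump_eq hj hf (by linarith) hab' (by linarith) (by linarith) hab
        (by linarith), sub_self, mul_zero]
  · set k₁ : ℂ → ℂ := fun w => (c - z)⁻¹ * dbar β' w with hk₁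
    set k₂ : ℂ → ℂ := fun w => dbar β w * ((c - w) / ((w - z) * (c - z))) with hk₂
    have hdist : ∀ w, dbar β w ≠ 0 → ‖z - c‖ / 2 ≤ ‖w - z‖ ∧ ‖w - c‖ ≤ 2 * r j := fun w hw => by
      have h1 := norm_le_of_dbar_bump_ne_zero ha hab hw
      have := norm_sub_le_norm_sub_add_norm_sub z w c
      rw [norm_sub_rev z w] at this
      constructor <;> linarith
    have hdecomp : ∀ w, dbar β w / (w - z) + (c - z)⁻¹ * (dbar β' w - dbar β w) =
        k₁ w + k₂ w := fun w => by
      by_cases hw : dbar β w = 0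
      · simp [hk₁, hk₂, hw]
      · have hwz : w - z ≠ 0 := by
          rw [← norm_pos_iff]
          have := (hdist w hw).1
          linarith
        simp only [hk₁, hk₂]
        field_simp
        ring
    have hm₁ : Measurable k₁ := ((continuous_dbar_bump ha' hab').measurable).const_mul _
    have hlog := hj.log_le
    rw [show s j / (4 * r j) = s j / 2 / (2 * r j) by field_simp; norm_num] at hlog
    have hL : 0 < -Real.log (r j) / 4 := by linarith
    have b₁ : ∫⁻ w, ‖k₁ w‖ₑ ^ 2 ≤ ENNReal.ofReal (4 * C₀ * holeTerm p r z j) := by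
      refine (hb c _ _ (1 / ‖z - c‖) _ ha' hab' (by positivity) fun w => ?_).trans
        (ENNReal.ofReal_le_ofReal ?_)
      · simp only [hk₁]
        rw [norm_mul, norm_inv, norm_sub_rev, one_div]
      · calc C₀ * (1 / ‖z - c‖) ^ 2 / Real.log (s j / 2 / (2 * r j))
            ≤ C₀ * (1 / ‖z - c‖) ^ 2 / (-Real.log (r j) / 4) := by gcongr; linarith
          _ = 4 * C₀ * (1 / (‖z - c‖ ^ 2 * (-Real.log (r j)))) := by
            have : Real.log (r j) ≠ 0 := hl.ne
            field_simp
          _ ≤ _ := by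
            gcongr
            unfold holeTerm
            have : 0 ≤ r j ^ 2 / (‖z - p j‖ ^ 2 - r j ^ 2) ^ 2 := by positivity
            linarith
    have hlog43 : 0 < Real.log (4 / 3) := Real.log_pos (by norm_num)
    have b₂ : ∫⁻ w, ‖k₂ w‖ₑ ^ 2 ≤
        ENNReal.ofReal (16 * C₀ / Real.log (4 / 3) * holeTerm p r z j) := by
      refine (hb c _ _ (4 * r j / ‖z - c‖ ^ 2) _ ha hab (by positivity) fun w => ?_).trans
        (ENNReal.ofReal_le_ofReal ?_)
      · by_cases hw : dbar β w = 0
        · simp [hk₂, hw, ← hβ]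
        · obtain ⟨h1, h2⟩ := hdist w hw
          simp only [hk₂]
          rw [norm_mul, norm_div, norm_mul, norm_sub_rev c w, norm_sub_rev c z, mul_comm]
          refine mul_le_mul_of_nonneg_right ?_ (norm_nonneg _)
          calc ‖w - c‖ / (‖w - z‖ * ‖z - c‖) ≤ 2 * r j / (‖z - c‖ / 2 * ‖z - c‖) := by gcongr
            _ = _ := by field_simp; norm_num
      · rw [show 2 * r j / (3 / 2 * r j) = 4 / 3 by field_simp; norm_num]
        have hlt : r j ^ 2 < ‖z - c‖ ^ 2 := by nlinarith
        have h0 := h.summand_nonneg z j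
        calc C₀ * (4 * r j / ‖z - c‖ ^ 2) ^ 2 / Real.log (4 / 3)
            = 16 * C₀ / Real.log (4 / 3) * (r j ^ 2 / (‖z - c‖ ^ 2) ^ 2) := by
              field_simp
              norm_num
          _ ≤ 16 * C₀ / Real.log (4 / 3) * (r j ^ 2 / (‖z - c‖ ^ 2 - r j ^ 2) ^ 2) := by
              have : 0 < ‖z - c‖ ^ 2 - r j ^ 2 := by linarith
              gcongr
              nlinarith
          _ ≤ _ := by
              gcongr
              unfold holeTerm
              linarith
    have hX := h.holeTerm_nonneg z j
    calc ∫⁻ w, ‖dbar β w / (w - z) + (c - z)⁻¹ * (dbar β' w - dbar β w)‖ₑ ^ 2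
        ≤ ∫⁻ w, 2 * (‖k₁ w‖ₑ ^ 2 + ‖k₂ w‖ₑ ^ 2) := lintegral_mono fun w => by
          rw [hdecomp]
          exact enorm_add_sq_le _ _
      _ = 2 * ((∫⁻ w, ‖k₁ w‖ₑ ^ 2) + ∫⁻ w, ‖k₂ w‖ₑ ^ 2) := by
          rw [lintegral_const_mul' _ _ (by simp), lintegral_add_left (hm₁.enorm.pow_const 2)]
      _ ≤ 2 * (ENNReal.ofReal (4 * C₀ * holeTerm p r z j) +
          ENNReal.ofReal (16 * C₀ / Real.log (4 / 3) * holeTerm p r z j)) := by gcongr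
      _ = _ := by
          rw [← ENNReal.ofReal_add (by positivity) (by positivity),
            show (2 : ENNReal) = ENNReal.ofReal 2 by simp, ← ENNReal.ofReal_mul (by norm_num)]
          congr 1
          ring

omit h in
lemma _root_.IsHoleKernel.mono {z : ℂ} {C C' : ℝ} {j : ℕ} {a b : ℝ} {q : ℂ → ℂ}
    (hq : IsHoleKernel p r s z C j a b q) (hC : C ≤ C') (hX : 0 ≤ holeTerm p r z j) :
    IsHoleKernel p r s z C' j a b q :=
  { hq with
    bound := hq.bound.trans (ENNReal.ofReal_le_ofReal (mul_le_mul_of_nonneg_right hC hX)) }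

lemma exists_holeKernel : ∃ C : ℝ, 0 < C ∧ ∀ z j, IsSmallHole p r s t j →
    4 * r j < ‖z - p j‖ → ∃ a b q, IsHoleKernel p r s z C j a b q := by
  obtain ⟨C₀, hC₀, hb⟩ := exists_lintegral_dbar_bump_bound
  have hlog43 : 0 < Real.log (4 / 3) := Real.log_pos (by norm_num)
  refine ⟨16 * C₀ + 2 * (4 * C₀ + 16 * C₀ / Real.log (4 / 3)), by positivity,
    fun z j hj hz => ?_⟩
  have hX := h.holeTerm_nonneg z j
  rcases le_or_gt (s j) ‖z - p j‖ with hs | hs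
  · exact ⟨_, _, _, (h.exists_holeKernel_of_far hC₀ hb hj hs).mono
      (le_add_of_nonneg_right (by positivity)) hX⟩
  · obtain ⟨q, hq⟩ := h.exists_holeKernel_of_near hC₀ hb hj hs hz
    exact ⟨_, _, q, hq.mono (le_add_of_nonneg_left (by positivity)) hX⟩

end IsHoleSystem

/-! ### Gluing the local cutoffs -/

namespace IsHoleSystem

variable {p : ℕ → ℂ} {r s t : ℕ → ℝ} (h : IsHoleSystem p r s t)

include h

lemma exists_forall_ne_lt (w : ℂ) : ∃ j, ∀ i ≠ j, t i < ‖w - p i‖ := by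
  by_cases hw : ∃ j, ‖w - p j‖ ≤ t j
  · obtain ⟨j, hj⟩ := hw
    refine ⟨j, fun i hij => ?_⟩
    by_contra! hi
    exact disjoint_left.1 (h.disj i j hij) (by rwa [Metric.mem_closedBall, dist_eq_norm])
      (by rwa [Metric.mem_closedBall, dist_eq_norm])
  · push Not at hw
    exact ⟨0, fun i _ => hw i⟩

/-- Every point lies in at most one of the discs of radius $t_j$, so a sum of functions supported
there has at most one nonzero summand. -/
lemma sum_eq_zero_or_eq {M : Type*} [AddCommMonoid M] (J : Finset ℕ) {F : ℕ → ℂ → M}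
    (hF : ∀ j ∈ J, ∀ w, t j < ‖w - p j‖ → F j w = 0) (w : ℂ) :
    ∑ j ∈ J, F j w = 0 ∨ ∃ j ∈ J, ∑ j ∈ J, F j w = F j w := by
  obtain ⟨j, hj⟩ := h.exists_forall_ne_lt w
  by_cases hjJ : j ∈ J
  · exact Or.inr ⟨j, hjJ, Finset.sum_eq_single_of_mem j hjJ fun i hi hij => hF i hi w (hj i hij)⟩
  · exact Or.inl (Finset.sum_eq_zero fun i hi => hF i hi w (hj i fun hij => hjJ (hij ▸ hi)))

end IsHoleSystem

/-- A global cutoff, vanishing off the disc of radius `ε`, near the origin and near the holes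
indexed by `J`. -/
noncomputable def holeCutoff (p : ℕ → ℂ) (a b : ℕ → ℝ) (J : Finset ℕ) (ε η : ℝ) (w : ℂ) : ℝ :=
  (bump 0 (ε / 2) ε w - bump 0 (η ^ 2) η w) * (1 - ∑ j ∈ J, bump (p j) (a j) (b j) w)

section holeCutoff

variable {p : ℕ → ℂ} {a b : ℕ → ℝ} {J : Finset ℕ} {ε η : ℝ}

lemma contDiff_holeCutoff (hε : 0 < ε) (hη : 0 < η) (hη1 : η < 1)
    (hab : ∀ j ∈ J, 0 < a j ∧ a j < b j) : ContDiff ℝ 1 (holeCutoff p a b J ε η) :=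
  ((contDiff_bump (half_pos hε) (half_lt_self hε)).sub
    (contDiff_bump (pow_pos hη 2) (by nlinarith))).mul
    (contDiff_const.sub (ContDiff.sum fun j hj => contDiff_bump (hab j hj).1 (hab j hj).2))

lemma hasCompactSupport_holeCutoff (hε : 0 < ε) (hη : 0 < η) (hη1 : η < 1) :
    HasCompactSupport (holeCutoff p a b J ε η) :=
  ((hasCompactSupport_bump (half_pos hε) (half_lt_self hε)).sub
    (hasCompactSupport_bump (pow_pos hη 2) (by nlinarith))).mul_right

lemma dbar_holeCutoff (hε : 0 < ε) (hη : 0 < η) (hη1 : η < 1)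
    (hab : ∀ j ∈ J, 0 < a j ∧ a j < b j) (w : ℂ) :
    dbar (holeCutoff p a b J ε η) w =
      ((1 - ∑ j ∈ J, bump (p j) (a j) (b j) w : ℝ) : ℂ) *
        (dbar (bump 0 (ε / 2) ε) w - dbar (bump 0 (η ^ 2) η) w) -
      ((bump 0 (ε / 2) ε w - bump 0 (η ^ 2) η w : ℝ) : ℂ) *
        ∑ j ∈ J, dbar (bump (p j) (a j) (b j)) w := by
  have h1 : DifferentiableAt ℝ (bump 0 (ε / 2) ε) w :=
    (contDiff_bump (half_pos hε) (half_lt_self hε)).differentiable one_ne_zero w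
  have h2 : DifferentiableAt ℝ (bump 0 (η ^ 2) η) w :=
    (contDiff_bump (pow_pos hη 2) (by nlinarith)).differentiable one_ne_zero w
  have h3 : ∀ j ∈ J, DifferentiableAt ℝ (bump (p j) (a j) (b j)) w := fun j hj =>
    (contDiff_bump (hab j hj).1 (hab j hj).2).differentiable one_ne_zero w
  have h4 : DifferentiableAt ℝ (fun w => ∑ j ∈ J, bump (p j) (a j) (b j) w) w :=
    DifferentiableAt.fun_sum h3
  unfold holeCutoff
  rw [dbar_mul (h1.fun_sub h2) ((differentiableAt_const _).fun_sub h4), dbar_sub h1 h2,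
    dbar_sub (differentiableAt_const _) h4, dbar_sum h3, dbar_const]
  ring

lemma holeCutoff_eventuallyEq_zero_of_lt (hε : 0 < ε) (hη : 0 < η) (hη1 : η < 1) (hηε : η < ε)
    {w : ℂ} (hw : ε < ‖w‖) : holeCutoff p a b J ε η =ᶠ[𝓝 w] 0 := by
  filter_upwards [bump_eventuallyEq_zero (c := 0) (half_pos hε) (half_lt_self hε) (w := w)
      (by simpa using hw),
    bump_eventuallyEq_zero (c := 0) (pow_pos hη 2) (show η ^ 2 < η by nlinarith) (w := w)
      (by simpa using hηε.trans hw)] with x h1 h2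
  simp [holeCutoff, h1, h2]

lemma holeCutoff_eventuallyEq_zero_of_norm_lt (hη : 0 < η) (hη1 : η < 1) (hηε : η < ε / 2)
    {w : ℂ} (hw : ‖w‖ < η ^ 2) : holeCutoff p a b J ε η =ᶠ[𝓝 w] 0 := by
  filter_upwards [bump_eventuallyEq_one (c := 0) (a := ε / 2) (b := ε) (w := w)
      (by rw [sub_zero]; nlinarith),
    bump_eventuallyEq_one (c := 0) (a := η ^ 2) (b := η) (w := w)
      (by simpa using hw)] with x h1 h2
  simp [holeCutoff, h1, h2]

lemma holeCutoff_eventuallyEq_one (hη : 0 < η) (hη1 : η < 1)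
    (hab : ∀ j ∈ J, 0 < a j ∧ a j < b j) {z : ℂ} (hz : ‖z‖ < ε / 2) (hz' : η < ‖z‖)
    (hb : ∀ j ∈ J, b j < ‖z - p j‖) : holeCutoff p a b J ε η =ᶠ[𝓝 z] fun _ => 1 := by
  have h3 : ∀ᶠ x in 𝓝 z, ∀ j ∈ J, bump (p j) (a j) (b j) x = 0 := by
    rw [Filter.eventually_all_finset]
    exact fun j hj => bump_eventuallyEq_zero (hab j hj).1 (hab j hj).2 (hb j hj)
  filter_upwards [bump_eventuallyEq_one (c := 0) (a := ε / 2) (b := ε) (w := z) (by simpa using hz),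
    bump_eventuallyEq_zero (c := 0) (pow_pos hη 2) (show η ^ 2 < η by nlinarith) (w := z)
      (by simpa using hz'), h3] with x h1 h2 h3
  simp [holeCutoff, h1, h2, Finset.sum_eq_zero h3]

end holeCutoff

namespace IsHoleSystem

variable {p : ℕ → ℂ} {r s t : ℕ → ℝ} (h : IsHoleSystem p r s t)

include h

/-- A hole outside `J` lies where the radial factor vanishes, either beyond $\varepsilon$ or within
$\eta^2$ of the origin. Near a hole in `J` its own bump is 1 and all others are 0, so the second
factor vanishes. -/
lemma holeCutoff_eventuallyEq_zero {a b : ℕ → ℝ} {J : Finset ℕ} {ε η : ℝ} (hε : 0 < ε)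
    (hε1 : ε < 1) (hη : 0 < η) (hη1 : η < 1) (hηε : η < ε / 2)
    (hab : ∀ j ∈ J, r j < a j ∧ a j < b j ∧ b j < s j)
    (hJ : ∀ j ∉ J, ε < ‖p j‖ - r j ∨ ‖p j‖ + r j < η ^ 2) {w : ℂ} (hw : w ∉ holeDomain p r) :
    holeCutoff p a b J ε η =ᶠ[𝓝 w] 0 := by
  by_cases hw1 : ε < ‖w‖
  · exact holeCutoff_eventuallyEq_zero_of_lt hε hη hη1 (by linarith) hw1
  by_cases hw0 : ‖w‖ < η ^ 2
  · exact holeCutoff_eventuallyEq_zero_of_norm_lt hη hη1 hηε hw0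
  have hwE : w ∈ unitDisc := by
    simp only [unitDisc, Metric.mem_ball, dist_zero_right]
    linarith
  have hwne : w ∉ ({0} : Set ℂ) := fun h0 => hw0 (by
    rw [mem_singleton_iff.1 h0, norm_zero]
    positivity)
  have hwU : w ∈ ⋃ j, Metric.closedBall (p j) (r j) := by
    by_contra hwU
    exact hw ⟨hwE, fun hc => hc.elim hwU hwne⟩
  obtain ⟨j, hj⟩ := mem_iUnion.1 hwU
  rw [Metric.mem_closedBall, dist_eq_norm] at hj
  have hjJ : j ∈ J := by
    by_contra hjJ
    rcases hJ j hjJ with h1 | h1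
    · have := norm_sub_norm_le (p j) w
      rw [norm_sub_rev] at this
      exact hw1 (by linarith)
    · have := norm_sub_norm_le w (p j)
      exact hw0 (by linarith)
  obtain ⟨h1, h2, h3⟩ := hab j hjJ
  have hev : ∀ᶠ x in 𝓝 w, ‖x - p j‖ < a j :=
    (by fun_prop : Continuous fun x : ℂ => ‖x - p j‖).continuousAt.eventually_lt
      continuousAt_const (hj.trans_lt h1)
  filter_upwards [hev] with x hx
  have hsum : ∑ i ∈ J, bump (p i) (a i) (b i) x = bump (p j) (a j) (b j) x := by
    refine Finset.sum_eq_single_of_mem j hjJ fun i hi hij => ?_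
    obtain ⟨h1', h2', h3'⟩ := hab i hi
    refine bump_of_ge ((h.r_pos i).trans h1') h2' ?_
    by_contra! hlt
    have e1 := h.s_lt_t i
    have e2 := h.s_lt_t j
    refine disjoint_left.1 (h.disj i j hij) (?_ : x ∈ _) ?_ <;>
      · rw [Metric.mem_closedBall, dist_eq_norm]
        linarith
  simp [holeCutoff, hsum, bump_of_le hx.le]

end IsHoleSystem

/-! ### The global kernel near the origin -/

namespace IsHoleSystem

variable {p : ℕ → ℂ} {r s t : ℕ → ℝ} (h : IsHoleSystem p r s t)

include h

lemma enorm_sum_sq_le (J : Finset ℕ) {F : ℕ → ℂ → ℂ}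
    (hF : ∀ j ∈ J, ∀ w, t j < ‖w - p j‖ → F j w = 0) (w : ℂ) :
    ‖∑ j ∈ J, F j w‖ₑ ^ 2 ≤ ∑ j ∈ J, ‖F j w‖ₑ ^ 2 := by
  rcases h.sum_eq_zero_or_eq J hF w with h0 | ⟨j, hj, h1⟩
  · simp [h0]
  · rw [h1]
    exact Finset.single_le_sum (f := fun j => ‖F j w‖ₑ ^ 2) (fun _ _ => zero_le) hj

lemma sum_bump_mem_Icc {J : Finset ℕ} {a b : ℕ → ℝ}
    (hab : ∀ j ∈ J, 0 < a j ∧ a j < b j ∧ b j < s j) (w : ℂ) :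
    ∑ j ∈ J, bump (p j) (a j) (b j) w ∈ Icc (0 : ℝ) 1 := by
  rcases h.sum_eq_zero_or_eq J (F := fun j => bump (p j) (a j) (b j)) (fun j hj w hw =>
    bump_of_ge (hab j hj).1 (hab j hj).2.1
      (by linarith [(hab j hj).2.2, h.s_lt_t j])) w with h0 | ⟨j, hj, h1⟩
  · simp [h0]
  · rw [h1]
    exact ⟨bump_nonneg _, bump_le_one _⟩

/-- The kernel obtained from the global cutoff and the corrections `q j` represents point
evaluation at `z`. -/
lemma setIntegral_mul_kernel {z : ℂ} (hz : z ∈ holeDomain p r) {C ε η : ℝ} {J : Finset ℕ}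
    {a b : ℕ → ℝ} {q : ℕ → ℂ → ℂ}
    (hq : ∀ j ∈ J, IsHoleKernel p r s z C j (a j) (b j) (q j))
    (hsm : ∀ j ∈ J, IsSmallHole p r s t j)
    (hε : 0 < ε) (hε1 : ε < 1) (hzε : ‖z‖ < ε / 2) (hη : 0 < η) (hηz : η < ‖z‖)
    (hJ : ∀ j ∉ J, ε < ‖p j‖ - r j ∨ ‖p j‖ + r j < η ^ 2)
    {f : ℂ → ℂ} (hf : DifferentiableOn ℂ f (holeDomain p r)) :
    ∫ w in holeDomain p r, f w * (-(1 / Real.pi : ℂ) *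
      (dbar (holeCutoff p a b J ε η) w / (w - z) - ∑ j ∈ J, q j w)) = f z := by
  have hη1 : η < 1 := by linarith
  have hab : ∀ j ∈ J, 0 < a j ∧ a j < b j := fun j hj =>
    ⟨(h.r_pos j).trans (hq j hj).r_lt, (hq j hj).lt⟩
  have hχ0 : ∀ w ∉ holeDomain p r, holeCutoff p a b J ε η =ᶠ[𝓝 w] 0 := fun w hw =>
    h.holeCutoff_eventuallyEq_zero hε hε1 hη hη1 (by linarith)
      (fun j hj => ⟨(hq j hj).r_lt, (hq j hj).lt, (hq j hj).lt_s⟩) hJ hw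
  obtain ⟨i1, e1⟩ := integral_mul_dbar_div h.isOpen_holeDomain hf hz
    (contDiff_holeCutoff hε hη hη1 hab) (hasCompactSupport_holeCutoff hε hη hη1)
    (holeCutoff_eventuallyEq_one hη hη1 hab hzε hηz fun j hj => (hq j hj).lt_norm) hχ0
  have i2 : Integrable fun w => ∑ j ∈ J, f w * q j w :=
    integrable_finsetSum _ fun j hj => (hq j hj).integrable f hf
  rw [setIntegral_eq_integral_of_forall_compl_eq_zero fun w hw => ?_]
  · calc _ = ∫ w, -(1 / Real.pi : ℂ) * (f w * (dbar (holeCutoff p a b J ε η) w / (w - z)) -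
          ∑ j ∈ J, f w * q j w) := by
          congr 1 with w
          rw [← Finset.mul_sum]
          ring
      _ = -(1 / Real.pi : ℂ) * (-Real.pi * f z - ∑ j ∈ J, 0) := by
          rw [integral_const_mul, integral_sub i1 i2, e1,
            integral_finsetSum _ fun j hj => (hq j hj).integrable f hf]
          congr 2
          exact Finset.sum_congr rfl fun j hj => (hq j hj).integral f hf
      _ = f z := by
          have hpi : (Real.pi : ℂ) ≠ 0 := by exact_mod_cast Real.pi_ne_zero
          rw [Finset.sum_const_zero]
          field_simp
          ring
  · rw [dbar_eq_zero_of_eventuallyEq (c := 0) (hχ0 w hw), Finset.sum_eq_zero fun j hj =>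
      (hq j hj).eq_zero w fun hw' => hw (h.annulus_subset (hsm j hj) hw'.1
        (hw'.2.trans (h.s_lt_t j)))]
    simp

/-- The product rule gives $Bx-By-\theta\sum_j k_j$ with $|B|,|\theta|\le1$, where $x$, $y$ come
from the outer and inner cutoffs and the $k_j$ are the corrected local kernels. The factor 4 comes
from two uses of $|u+v|^2\le2(|u|^2+|v|^2)$; the $k_j$ have disjoint supports and cost no factor. -/
lemma enorm_kernel_sq_le {z : ℂ} {C ε η : ℝ} {J : Finset ℕ}
    {a b : ℕ → ℝ} {q : ℕ → ℂ → ℂ}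
    (hq : ∀ j ∈ J, IsHoleKernel p r s z C j (a j) (b j) (q j))
    (hsm : ∀ j ∈ J, IsSmallHole p r s t j)
    (hε : 0 < ε) (hε1 : ε < 1) (hzε : ‖z‖ < ε / 4) (hη : 0 < η) (hηz : η < ‖z‖ / 2) (w : ℂ) :
    ‖-(1 / Real.pi : ℂ) * (dbar (holeCutoff p a b J ε η) w / (w - z) - ∑ j ∈ J, q j w)‖ₑ ^ 2 ≤
      4 * (‖dbar (bump 0 (ε / 2) ε) w / (w - z)‖ₑ ^ 2 +
        ‖dbar (bump 0 (η ^ 2) η) w / (w - z)‖ₑ ^ 2 +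
        ∑ j ∈ J, ‖dbar (bump (p j) (a j) (b j)) w / (w - z) + q j w‖ₑ ^ 2) := by
  have hzn := norm_nonneg z
  have hη1 : η < 1 := by linarith
  have hη2 : η ^ 2 < η := by nlinarith
  have hab : ∀ j ∈ J, 0 < a j ∧ a j < b j := fun j hj =>
    ⟨(h.r_pos j).trans (hq j hj).r_lt, (hq j hj).lt⟩
  obtain ⟨hB0, hB1⟩ := h.sum_bump_mem_Icc (J := J) (a := a) (b := b)
    (fun j hj => ⟨(hab j hj).1, (hab j hj).2, (hq j hj).lt_s⟩) w
  set B := 1 - ∑ j ∈ J, bump (p j) (a j) (b j) w with hB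
  set θ := bump 0 (ε / 2) ε w - bump 0 (η ^ 2) η w with hθ
  have hθ1 : |θ| ≤ 1 := by
    rw [abs_le]
    have h1 := bump_nonneg (c := 0) (a := ε / 2) (b := ε) w
    have h2 := bump_nonneg (c := 0) (a := η ^ 2) (b := η) w
    have h3 := bump_le_one (c := 0) (a := ε / 2) (b := ε) w
    have h4 := bump_le_one (c := 0) (a := η ^ 2) (b := η) w
    constructor <;> linarith
  -- A nonzero correction forces both $z$ and $w$ into the disc of radius $s_j\le t_j/4\le|z_j|/4$
  -- about $z_j$. Hence $|w|$ is comparable to $|z|$ and lies between $\eta$ and $\varepsilon/2$,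
  -- where $\theta=1$. So the correction may be grouped with its bump under the factor $\theta$.
  have hθq : ∀ j ∈ J, (θ : ℂ) * q j w = q j w := fun j hj => by
    by_cases hqw : q j w = 0
    · simp [hqw]
    have hws : ‖w - p j‖ < s j := by
      by_contra! hc
      exact hqw ((hq j hj).eq_zero w fun hw' => hc.not_gt hw'.2)
    have hzs : ‖z - p j‖ < s j := by
      by_contra! hc
      exact hqw (by rw [(hq j hj).near hc]; rfl)
    have h1 := (hsm j hj).s_le
    have h2 := h.t_le_norm j
    have h3 := norm_sub_norm_le (p j) z
    have h4 := norm_sub_norm_le w (p j)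
    have h5 := norm_sub_norm_le z (p j)
    have h6 := norm_sub_norm_le (p j) w
    rw [norm_sub_rev] at h3 h6
    have hθ : θ = 1 := by
      rw [hθ, bump_of_le (by rw [sub_zero]; linarith),
        bump_of_ge (pow_pos hη 2) hη2 (by rw [sub_zero]; linarith), sub_zero]
    rw [hθ, ofReal_one, one_mul]
  set x := dbar (bump 0 (ε / 2) ε) w / (w - z) with hx
  set y := dbar (bump 0 (η ^ 2) η) w / (w - z) with hy
  set k : ℕ → ℂ → ℂ := fun j w => dbar (bump (p j) (a j) (b j)) w / (w - z) + q j w with hk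
  have hdecomp : dbar (holeCutoff p a b J ε η) w / (w - z) - ∑ j ∈ J, q j w =
      B * x + (-(B * y) + -(θ * ∑ j ∈ J, k j w)) := by
    rw [dbar_holeCutoff hε hη hη1 hab, ← hB, ← hθ]
    simp only [hk]
    rw [Finset.sum_add_distrib, mul_add, Finset.mul_sum (s := J) (f := fun j => q j w),
      Finset.sum_congr rfl hθq, ← Finset.sum_div, hx, hy]
    ring
  have hmul : ∀ (u : ℝ) (v : ℂ), |u| ≤ 1 → ‖(u : ℂ) * v‖ₑ ^ 2 ≤ ‖v‖ₑ ^ 2 := fun u v hu => by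
    refine pow_le_pow_left' ?_ 2
    rw [enorm_mul]
    refine mul_le_of_le_one_left' ?_
    rw [← ofReal_norm, norm_real, Real.norm_eq_abs]
    exact ENNReal.ofReal_le_one.2 hu
  have hB' : |B| ≤ 1 := by
    rw [abs_le]
    constructor <;> linarith
  have hpi : |-(1 / Real.pi)| ≤ 1 := by
    rw [abs_neg, abs_of_pos (by positivity), div_le_one Real.pi_pos]
    linarith [Real.pi_gt_three]
  have hksum : ‖∑ j ∈ J, k j w‖ₑ ^ 2 ≤ ∑ j ∈ J, ‖k j w‖ₑ ^ 2 := by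
    refine h.enorm_sum_sq_le J (fun j hj w hw => ?_) w
    have h1 := h.s_lt_t j
    have h2 := (hq j hj).lt_s
    simp only [hk]
    rw [dbar_bump_of_gt (hab j hj).1 (hab j hj).2 (by linarith),
      (hq j hj).eq_zero w fun hw' => by linarith [hw'.2]]
    simp
  have h1 := hmul B x hB'
  have h2 : ‖-(B * y)‖ₑ ^ 2 ≤ ‖y‖ₑ ^ 2 := by
    rw [enorm_neg]
    exact hmul B y hB'
  have h3 : ‖-(θ * ∑ j ∈ J, k j w)‖ₑ ^ 2 ≤ ∑ j ∈ J, ‖k j w‖ₑ ^ 2 := by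
    rw [enorm_neg]
    exact (hmul θ _ hθ1).trans hksum
  have h4 := hmul (-(1 / Real.pi)) (B * x + (-(B * y) + -(θ * ∑ j ∈ J, k j w))) hpi
  rw [hdecomp, show -(1 / Real.pi : ℂ) = ((-(1 / Real.pi) : ℝ) : ℂ) by push_cast; rfl]
  calc _ ≤ _ := h4
    _ ≤ 2 * (‖B * x‖ₑ ^ 2 + ‖-(B * y) + -(θ * ∑ j ∈ J, k j w)‖ₑ ^ 2) := enorm_add_sq_le _ _
    _ ≤ 2 * (‖x‖ₑ ^ 2 + 2 * (‖y‖ₑ ^ 2 + ∑ j ∈ J, ‖k j w‖ₑ ^ 2)) := by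
        gcongr
        exact (enorm_add_sq_le _ _).trans (by gcongr)
    _ ≤ 2 * (2 * ‖x‖ₑ ^ 2 + 2 * (‖y‖ₑ ^ 2 + ∑ j ∈ J, ‖k j w‖ₑ ^ 2)) := by
        gcongr
        exact le_mul_of_one_le_left' one_le_two
    _ = _ := by ring

/-- The bound for the Bergman kernel near the origin, off small neighbourhoods of the holes. -/
lemma exists_bound_near_zero {N : ℕ} (hN : ∀ j ≥ N, IsSmallHole p r s t j) {ε : ℝ} (hε : 0 < ε)
    (hε1 : ε < 1) (hεN : ∀ j < N, ε < ‖p j‖ - r j) : ∃ C : ℝ, 0 < C ∧ ∀ z ∈ holeDomain p r,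
    ‖z‖ < ε / 4 → (∀ j ≥ N, 4 * r j < ‖z - p j‖) →
    bergmanKernel (holeDomain p r) z ≤ ENNReal.ofReal C *
      (bergmanKernel unitDisc z + ENNReal.ofReal (∑' j, holeTerm p r z j)) := by
  obtain ⟨C₀, hC₀, hb⟩ := exists_lintegral_dbar_bump_bound
  obtain ⟨C₁, hC₁, hker⟩ := h.exists_holeKernel
  set A := 4 * (C₀ * (4 / ε) ^ 2 / Real.log 2 + 1) with hA
  have hlog2 : 0 < Real.log 2 := Real.log_pos one_lt_two
  have hA0 : 0 < A := by positivity
  refine ⟨16 * Real.pi * A + 4 * C₁, by positivity, fun z hz hzε hfar => ?_⟩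
  have hz0 : 0 < ‖z‖ := norm_pos_iff.2 (ne_zero_of_mem_holeDomain hz)
  -- `X` is the cost of the inner cutoff before division by $\log(\eta/\eta^2)=\log(1/\eta)$. Taking
  -- $\eta\le e^{-X}$ makes the quotient at most 1. Both $\eta$ and `J` depend on $z$, but the
  -- resulting bound does not.
  set X := C₀ * (2 / ‖z‖) ^ 2 with hX
  have hX0 : 0 < X := by positivity
  set η := min (‖z‖ / 4) (Real.exp (-X)) with hη
  have hη0 : 0 < η := lt_min (by positivity) (Real.exp_pos _)
  have hηz : η < ‖z‖ / 2 := (min_le_left _ _).trans_lt (by linarith)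
  have hη1 : η < 1 := by linarith
  have hη2 : η ^ 2 < η := by nlinarith
  have hηX : X ≤ Real.log (η / η ^ 2) := by
    have h1 := Real.log_le_log hη0 (min_le_right (‖z‖ / 4) (Real.exp (-X)))
    rw [Real.log_exp] at h1
    rw [show η / η ^ 2 = η⁻¹ by field_simp, Real.log_inv]
    linarith
  obtain ⟨N', hN'⟩ := eventually_atTop.1
    (h.tendsto_norm.eventually_lt_const (show 0 < η ^ 2 / 2 by positivity))
  set J := Finset.Ico N N' with hJ
  have hJN : ∀ j ∈ J, N ≤ j := fun j hj => (Finset.mem_Ico.1 hj).1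
  choose! a b q hq using fun j (hj : N ≤ j) => hker z j (hN j hj) (hfar j hj)
  have hqJ : ∀ j ∈ J, IsHoleKernel p r s z C₁ j (a j) (b j) (q j) := fun j hj => hq j (hJN j hj)
  have hsm : ∀ j ∈ J, IsSmallHole p r s t j := fun j hj => hN j (hJN j hj)
  have hab : ∀ j ∈ J, 0 < a j ∧ a j < b j := fun j hj =>
    ⟨(h.r_pos j).trans (hqJ j hj).r_lt, (hqJ j hj).lt⟩
  have hJ' : ∀ j ∉ J, ε < ‖p j‖ - r j ∨ ‖p j‖ + r j < η ^ 2 := fun j hj => by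
    by_cases hjN : j < N
    · exact Or.inl (hεN j hjN)
    · right
      have hj' : N' ≤ j := by
        by_contra! hlt
        exact hj (Finset.mem_Ico.2 ⟨not_lt.1 hjN, hlt⟩)
      linarith [hN' j hj', h.r_lt_norm j]
  have hmχ : Measurable (dbar (holeCutoff p a b J ε η)) :=
    (continuous_dbar (contDiff_holeCutoff hε hη0 hη1 hab)).measurable
  have hmq : Measurable fun w => ∑ j ∈ J, q j w :=
    Finset.measurable_sum _ fun j hj => (hqJ j hj).continuous.measurable
  have hmo : Measurable (dbar (bump 0 (ε / 2) ε)) :=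
    (continuous_dbar_bump (half_pos hε) (half_lt_self hε)).measurable
  have hmi : Measurable (dbar (bump 0 (η ^ 2) η)) :=
    (continuous_dbar_bump (pow_pos hη0 2) hη2).measurable
  have bo : ∫⁻ w, ‖dbar (bump 0 (ε / 2) ε) w / (w - z)‖ₑ ^ 2 ≤
      ENNReal.ofReal (C₀ * (4 / ε) ^ 2 / Real.log 2) := by
    refine (hb 0 (ε / 2) ε (4 / ε) _ (half_pos hε) (half_lt_self hε) (by positivity)
      fun w => ?_).trans (le_of_eq ?_)
    · by_cases hw : dbar (bump 0 (ε / 2) ε) w = 0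
      · simp [hw]
      · have h1 := le_norm_of_dbar_bump_ne_zero hw
        rw [sub_zero] at h1
        have h2 := norm_sub_norm_le w z
        rw [norm_div]
        calc _ ≤ ‖dbar (bump 0 (ε / 2) ε) w‖ / (ε / 4) := by gcongr; linarith
          _ = _ := by field_simp
    · rw [show ε / (ε / 2) = 2 by field_simp]
  have bi : ∫⁻ w, ‖dbar (bump 0 (η ^ 2) η) w / (w - z)‖ₑ ^ 2 ≤ ENNReal.ofReal 1 := by
    refine (hb 0 (η ^ 2) η (2 / ‖z‖) _ (pow_pos hη0 2) hη2 (by positivity)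
      fun w => ?_).trans (ENNReal.ofReal_le_ofReal ?_)
    · by_cases hw : dbar (bump 0 (η ^ 2) η) w = 0
      · simp [hw]
      · have h1 := norm_le_of_dbar_bump_ne_zero (pow_pos hη0 2) hη2 hw
        rw [sub_zero] at h1
        have h2 := norm_sub_norm_le z w
        rw [norm_sub_rev] at h2
        rw [norm_div]
        calc _ ≤ ‖dbar (bump 0 (η ^ 2) η) w‖ / (‖z‖ / 2) := by gcongr; linarith
          _ = _ := by field_simp
    · rw [div_le_one (hX0.trans_le hηX)]
      exact hηX
  have bJ : ∑ j ∈ J, ∫⁻ w, ‖dbar (bump (p j) (a j) (b j)) w / (w - z) + q j w‖ₑ ^ 2 ≤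
      ENNReal.ofReal (C₁ * ∑' j, holeTerm p r z j) := by
    calc _ ≤ ∑ j ∈ J, ENNReal.ofReal (C₁ * holeTerm p r z j) :=
          Finset.sum_le_sum fun j hj => (hqJ j hj).bound
      _ = ENNReal.ofReal (C₁ * ∑ j ∈ J, holeTerm p r z j) := by
          rw [← ENNReal.ofReal_sum_of_nonneg fun j _ =>
            mul_nonneg hC₁.le (h.holeTerm_nonneg z j), Finset.mul_sum]
      _ ≤ _ := by
          gcongr
          exact (h.summable_holeTerm (ne_zero_of_mem_holeDomain hz)).sum_le_tsum J
            fun j _ => h.holeTerm_nonneg z j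
  calc bergmanKernel (holeDomain p r) z
      ≤ ∫⁻ w in holeDomain p r, ‖-(1 / Real.pi : ℂ) *
          (dbar (holeCutoff p a b J ε η) w / (w - z) - ∑ j ∈ J, q j w)‖ₑ ^ 2 :=
        bergmanKernel_le_of_repr (Measurable.aemeasurable (by fun_prop)) fun f hf =>
          h.setIntegral_mul_kernel hz hqJ hsm hε hε1 (by linarith) hη0 (by linarith) hJ' hf.1
    _ ≤ ∫⁻ w, ‖-(1 / Real.pi : ℂ) *
          (dbar (holeCutoff p a b J ε η) w / (w - z) - ∑ j ∈ J, q j w)‖ₑ ^ 2 :=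
        setLIntegral_le_lintegral _ _
    _ ≤ ∫⁻ w, 4 * (‖dbar (bump 0 (ε / 2) ε) w / (w - z)‖ₑ ^ 2 +
          ‖dbar (bump 0 (η ^ 2) η) w / (w - z)‖ₑ ^ 2 +
          ∑ j ∈ J, ‖dbar (bump (p j) (a j) (b j)) w / (w - z) + q j w‖ₑ ^ 2) :=
        lintegral_mono fun w => h.enorm_kernel_sq_le hqJ hsm hε hε1 hzε hη0 hηz w
    _ = 4 * ((∫⁻ w, ‖dbar (bump 0 (ε / 2) ε) w / (w - z)‖ₑ ^ 2) +
          (∫⁻ w, ‖dbar (bump 0 (η ^ 2) η) w / (w - z)‖ₑ ^ 2) +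
          ∑ j ∈ J, ∫⁻ w, ‖dbar (bump (p j) (a j) (b j)) w / (w - z) + q j w‖ₑ ^ 2) := by
        rw [lintegral_const_mul' _ _ (by simp), lintegral_add_left (by fun_prop),
          lintegral_add_left (by fun_prop), lintegral_finsetSum _ fun j hj => ?_]
        have h1 := (continuous_dbar_bump (c := p j) (hab j hj).1 (hab j hj).2).measurable
        have h2 := (hqJ j hj).continuous.measurable
        fun_prop
    _ ≤ 4 * (ENNReal.ofReal (C₀ * (4 / ε) ^ 2 / Real.log 2) + ENNReal.ofReal 1 +
          ENNReal.ofReal (C₁ * ∑' j, holeTerm p r z j)) := by gcongr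
    _ = ENNReal.ofReal A + ENNReal.ofReal (4 * C₁) * ENNReal.ofReal (∑' j, holeTerm p r z j) := by
        rw [← ENNReal.ofReal_add (by positivity) (by norm_num), mul_add,
          show (4 : ENNReal) = ENNReal.ofReal 4 by simp, ← ENNReal.ofReal_mul (by norm_num),
          ← ENNReal.ofReal_mul (by norm_num), ← ENNReal.ofReal_mul (by positivity), ← hA, mul_assoc]
    _ ≤ ENNReal.ofReal (16 * Real.pi * A) * bergmanKernel unitDisc z +
          ENNReal.ofReal (4 * C₁) * ENNReal.ofReal (∑' j, holeTerm p r z j) := by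
        gcongr
        exact ofReal_le_mul_bergmanKernel_unitDisc' hz.1 hA0.le
    _ ≤ ENNReal.ofReal (16 * Real.pi * A + 4 * C₁) * bergmanKernel unitDisc z +
          ENNReal.ofReal (16 * Real.pi * A + 4 * C₁) *
            ENNReal.ofReal (∑' j, holeTerm p r z j) := by
        have h1 : 0 ≤ 16 * Real.pi * A := by positivity
        gcongr <;> linarith
    _ = _ := (mul_add _ _ _).symm

/-! ### Combining the three regimes -/

lemma exists_bound : ∃ C : ℝ, 0 < C ∧ ∀ z ∈ holeDomain p r,
    bergmanKernel (holeDomain p r) z ≤ ENNReal.ofReal C *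
      (bergmanKernel unitDisc z + ENNReal.ofReal (∑' j, holeTerm p r z j)) := by
  obtain ⟨N, hN⟩ := eventually_atTop.1 h.eventually_isSmallHole
  obtain ⟨ε, hε, hε1, hεN⟩ : ∃ ε : ℝ, 0 < ε ∧ ε < 1 ∧ ∀ j < N, ε < ‖p j‖ - r j := by
    have h1 : ∀ᶠ ε : ℝ in 𝓝[>] 0, ∀ j ∈ Finset.range N, ε < ‖p j‖ - r j := by
      rw [Filter.eventually_all_finset]
      exact fun j _ => nhdsWithin_le_nhds (Iio_mem_nhds (sub_pos.2 (h.r_lt_norm j)))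
    have h2 : ∀ᶠ ε : ℝ in 𝓝[>] 0, ε < 1 := nhdsWithin_le_nhds (Iio_mem_nhds one_pos)
    obtain ⟨ε, ⟨h1, h2⟩, h3⟩ := ((h1.and h2).and self_mem_nhdsWithin).exists
    exact ⟨ε, h3, h2, fun j hj => h1 j (Finset.mem_range.2 hj)⟩
  obtain ⟨C₁, hC₁, h1⟩ := h.exists_bound_of_le_norm (δ := ε / 4) (by positivity)
  obtain ⟨C₂, hC₂, h2⟩ := h.exists_bound_of_near
  obtain ⟨C₃, hC₃, h3⟩ := h.exists_bound_near_zero hN hε hε1 hεN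
  have hmono : ∀ {c : ℝ} {x : ENNReal} (z : ℂ), c ≤ C₁ + C₂ + C₃ → x ≤ ENNReal.ofReal c *
      (bergmanKernel unitDisc z + ENNReal.ofReal (∑' j, holeTerm p r z j)) →
      x ≤ ENNReal.ofReal (C₁ + C₂ + C₃) *
      (bergmanKernel unitDisc z + ENNReal.ofReal (∑' j, holeTerm p r z j)) := fun z hc hx =>
    hx.trans (mul_le_mul' (ENNReal.ofReal_le_ofReal hc) le_rfl)
  refine ⟨C₁ + C₂ + C₃, by positivity, fun z hz => ?_⟩
  rcases le_or_gt (ε / 4) ‖z‖ with hzε | hzε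
  · exact hmono z (by linarith) (h1 z hz hzε)
  by_cases hnear : ∃ j ≥ N, ‖z - p j‖ ≤ 4 * r j
  · obtain ⟨j, hj, hle⟩ := hnear
    exact hmono z (by linarith) (h2 z hz j (hN j hj) hle)
  · push Not at hnear
    exact hmono z (by linarith) (h3 z hz hzε hnear)

end IsHoleSystem

theorem lemma2 (p : ℕ → ℂ) (r s t : ℕ → ℝ)
    (hr : ∀ j, 0 < r j) (hrs : ∀ j, r j < s j) (hst : ∀ j, s j < t j)
    (hp : ∀ j, p j ∈ unitDisc)
    (hdisj : ∀ j k, j ≠ k →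
      Disjoint (Metric.closedBall (p j) (t j)) (Metric.closedBall (p k) (t k)))
    (h0 : ∀ j, (0 : ℂ) ∉ Metric.closedBall (p j) (r j))
    (hlim : Filter.Tendsto p Filter.atTop (nhds 0))
    (ht : ∀ j, t j < Real.exp (-4))
    (hrp : ∀ j, r j ^ 2 < ‖p j‖ ^ 2 / 2)
    (hA : ∀ j, r j ^ 2 / t j ^ 2 + s j / t j
      + Real.sqrt (2 * Real.log (s j) / Real.log (r j)) < 1)
    (hB : ∀ j, 2 * Real.log (t j) / Real.log (r j)
      + Real.sqrt (2 * Real.log (s j) / Real.log (r j)) + s j / t j < 1)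
    (hsum1 : Summable fun j => s j / t j)
    (hsum2 : Summable fun j => Real.sqrt (Real.log (s j) / Real.log (r j)))
    (hsum3 : Summable fun j => -1 / Real.log (r j)) :
    ∃ C : ℝ, 0 < C ∧ ∀ z ∈ holeDomain p r,
      Summable (fun j => 1 / (‖z - p j‖ ^ 2 * (-Real.log (r j)))
          + r j ^ 2 / (‖z - p j‖ ^ 2 - r j ^ 2) ^ 2) ∧
      bergmanKernel (holeDomain p r) z ≤ ENNReal.ofReal C * (bergmanKernel unitDisc z
        + ENNReal.ofReal (∑' j, (1 / (‖z - p j‖ ^ 2 * (-Real.log (r j)))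
          + r j ^ 2 / (‖z - p j‖ ^ 2 - r j ^ 2) ^ 2))) := by
  have ht1 : ∀ j, t j < 1 := fun j => (ht j).trans (Real.exp_lt_one_iff.2 (by norm_num))
  have h : IsHoleSystem p r s t := by
    refine ⟨hr, hrs, hst, hdisj, hlim, ht1, fun j => ?_, hsum1.tendsto_atTop_zero, hsum3⟩
    have hs := (hr j).trans (hrs j)
    have htj := hs.trans (hst j)
    have hrl : Real.log (r j) < 0 :=
      Real.log_neg (hr j) (((hrs j).trans (hst j)).trans (ht1 j))
    -- The square root alone is below 1. As $\log r_j<0$, this says $\log r_j<2\log s_j$, that is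
    -- $r_j<s_j^2$, the source of the thickness of the annuli.
    have h1 : Real.sqrt (2 * Real.log (s j) / Real.log (r j)) < 1 := by
      have := hA j
      have : 0 ≤ r j ^ 2 / t j ^ 2 := by positivity
      have : 0 ≤ s j / t j := by positivity
      linarith
    rw [Real.sqrt_lt' one_pos, one_pow, div_lt_one_of_neg hrl] at h1
    exact h1.le
  obtain ⟨C, hC, hbound⟩ := h.exists_bound
  exact ⟨C, hC, fun z hz =>
    ⟨h.summable_holeTerm (ne_zero_of_mem_holeDomain hz), hbound z hz⟩⟩
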